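/- Let $\ell,m\ge 1$, and let $A=A_1+A_2+A_3$, $B=B_1+B_2+B_3$ be sums of monomials in $\mathbb F_2[\mathbb Z_\ell\times\mathbb Z_m]$, defining a bivariate-bicycle code with $H_X=[A\,|\,B]$, $H_Z=[B^{\top}|A^{\top}]$, data registers $q(L),q(R)$ and ancilla registers $q(X),q(Z)$, each indexed by $i\in\mathbb Z_\ell\times\mathbb Z_m$. A monomial acts on indices by translation and its transpose by the inverse translation. Consider the depth-8 extraction cycle with the following rounds (all $i$ in parallel; $c\to t$ is a CNOT with control $c$ and target $t$): (1) reset $q(X,i)$ to $|+\rangle$, $q(R,A_1^{\top}i)\to q(Z,i)$; (2) $q(X,i)\to q(L,A_2i)$, $q(R,A_3^{\top}i)\to q(Z,i)$; (3) $q(X,i)\to q(R,B_2i)$, $q(L,B_1^{\top}i)\to q(Z,i)$; (4) $q(X,i)\to q(R,B_1i)$, $q(L,B_2^{\top}i)\to q(Z,i)$; (5) $q(X,i)\to q(R,B_3i)$, $q(L,B_3^{\top}i)\to q(Z,i)$; (6) $q(X,i)\to q(L,A_1i)$, $q(R,A_2^{\top}i)\to q(Z,i)$; (7) $q(X,i)\to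 q(L,A_3i)$, $Z$-measurement of $q(Z,i)$; (8) $X$-measurement of $q(X,i)$, reset of $q(Z,i)$ to $|0\rangle$. Let $t\in\{3,4,5\}$ be one of the three $B$ rounds and $E_t$ its set of CNOT blocks. The block Pauli $P_e$ is $X_{\rm data}\otimes I_{\rm anc}$ on a $q(L)\to q(Z)$ block (these are the blocks relevant to the $X$ sector) and $Z_{\rm anc}\otimes Z_{\rm data}$ on a $q(X)\to q(R)$ block (relevant to the $Z$ sector). Let $\mathcal E_t$ be the map that applies the rest of the cycle (with or without the gates of round $t$ itself, that is, faults may be placed before or after these gates), sums over measurement outcomes, and traces out the ancillas. (a) For all $e\ne e'$ in $E_t$ the event $P_e\otimes P_{e'}$ propagates to a data Pauli $D$ of weight exactly $2$, i.e. $\mathcal E_t(S\rho S)=D\,\mathcal E_t(\rho)\,D$ for all $\rho$, where $S=P_e\otimes P_{e'}$. If $e,e'$ are both relevant to the $X$ (resp. $Z$) sector, $D$ is $X\otimes X$ on the two $q(L)$ qubits (resp. $Z\otimes Z$ on the two $q(R)$ qubits) of the two blocks. (b) Let $E\subseteq E_t$ be the set of coupled blocks (for example all of $E_t$, or the blocks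 relevant to one sector), and let $A$ be the set of unordered pairs $a=\{e,e'\}$ of distinct blocks of $E$, with $S_a=P_e\otimes P_{e'}$. Given a routed embedding $\phi$ (qubit positions and a routed curve per block, with separation $d_\phi(e,e')$ the closest approach of the curves), a nonnegative nonincreasing kernel $\kappa$ on $[0,\infty)$ with $\kappa(0)=1$, a coupling scale $J_0>0$ and a tick duration $\tau>0$, put $\theta_a=\tau J_0\kappa(d_\phi(e,e'))$, $\Theta_t=(\sum_{a\in A}\theta_a^2)^{1/2}$ and $U_t=\exp(-i\sum_{a\in A}\theta_aS_a)$. Let $N=\sum_{a\in A} Y_a$ with independent $Y_a\sim\mathrm{Bernoulli}(\sin^2\theta_a)$, and let $m_t$ be the largest number of sets $B\subseteq A$ with $|B|\ge2$ and $\prod_{a\in B}S_a$ equal to one given Pauli. Let $p_P$ be the total probability of the Paulis $Q$ in the Pauli twirl of $\rho\mapsto U_t\rho U_t^\dagger$ (in which $Q$ has probability $4^{-n}|\mathrm{tr}(QU_t)|^2$ on $n=4\ell m$ qubits) that propagate to the data Pauli $P$. Then $p_P$ are the Pauli probabilities of the twirled data channel: $\mathcal E_t\circ\mathcal T[\mathcal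 U_t]=\sum_P p_P\,P\,\mathcal E_t(\cdot)\,P$. For a sector $\sigma\in\{X,Z\}$ let $M^\sigma_{\ge3}(\phi)$ be the total probability of the data Paulis whose $\sigma$-type part has weight at least $3$. Then $$\Pr[N\ge2]\le\tfrac12\Theta_t^4,\qquad M^\sigma_{\ge3}(\phi)\le m_t\,\Pr[N\ge2],$$ and there is a finite $m_\ast$, depending only on the code (not on $t$, $E$, $\sigma$, $\phi$, $\kappa$, $J_0$, $\tau$), with $m_t\le m_\ast$ and $M^\sigma_{\ge3}(\phi)\le\tfrac12 m_\ast\Theta_t^4$. In particular $M^\sigma_{\ge3}(\phi)=O(\Theta_t^4)$ as $\Theta_t\to0$. -/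

import Mathlib

open scoped BigOperators Matrix

noncomputable section

namespace BBSchedule

/-! ### Paulis and operators on a finite set `V` of qubits -/

/-- Operators on the Hilbert space `(ℂ²)^{⊗V}`, as matrices in the computational basis. -/
abbrev Op (V : Type*) := Matrix (V → Fin 2) (V → Fin 2) ℂ

/-- Elements of `{I, X, Y, Z}^{⊗V}` (Paulis modulo phases) in binary form `(x, z)`:
the factor at `v` is `I, X, Z, Y` for `(x v, z v) = (0,0), (1,0), (0,1), (1,1)`.
Addition is multiplication modulo phases. -/
abbrev Pauli (V : Type*) := (V → ZMod 2) × (V → ZMod 2)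

/-- The one-qubit Pauli matrices. -/
def pauliMatrix (x z : ZMod 2) : Matrix (Fin 2) (Fin 2) ℂ :=
  if x = 0 then (if z = 0 then !![1, 0; 0, 1] else !![1, 0; 0, -1])
  else (if z = 0 then !![0, 1; 1, 0] else !![0, -Complex.I; Complex.I, 0])

/-- The Hermitian operator of a Pauli: the tensor product of its one-qubit factors. -/
def pauliOp {V : Type*} [Fintype V] (Q : Pauli V) : Op V :=
  Matrix.of fun a b => ∏ v, pauliMatrix (Q.1 v) (Q.2 v) (a v) (b v)

/-- `X` on the qubit `v`. -/
def pauliX {V : Type*} [DecidableEq V] (v : V) : Pauli V := (Pi.single v 1, 0)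

/-- `Z` on the qubit `v`. -/
def pauliZ {V : Type*} [DecidableEq V] (v : V) : Pauli V := (0, Pi.single v 1)

/-- The weight of a Pauli: the number of qubits on which it is not the identity. -/
def pauliWt {V : Type*} [Fintype V] (Q : Pauli V) : ℕ :=
  (Finset.univ.filter fun v => Q.1 v ≠ 0 ∨ Q.2 v ≠ 0).card

/-- The Pauli twirl `𝒯[𝒞] = 4^{-k} ∑_Q 𝒬 ∘ 𝒞 ∘ 𝒬`. -/
def pauliTwirl {V : Type*} [Fintype V] [DecidableEq V] (C : Op V → Op V) (ρ : Op V) : Op V :=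
  ((4 : ℂ) ^ Fintype.card V)⁻¹ •
    ∑ Q : Pauli V, pauliOp Q * C (pauliOp Q * ρ * pauliOp Q) * pauliOp Q

/-- The probability `4^{-k} |tr (Q U)|²` of the Pauli `Q` in the Pauli twirl of the unitary
channel of `U`. -/
def twirlProb {V : Type*} [Fintype V] [DecidableEq V] (U : Op V) (Q : Pauli V) : ℝ :=
  ‖Matrix.trace (pauliOp Q * U)‖ ^ 2 / (4 : ℝ) ^ Fintype.card V

/-! ### Circuit instructions -/

/-- The instructions of a syndrome-extraction circuit. -/
inductive Instr (V : Type*)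
  | prepX (q : V)
  | prepZ (q : V)
  | cnot (c t : V)
  | measX (q : V)
  | measZ (q : V)
  | idle (q : V)

/-- The operator of the CNOT with control `c` and target `t`. -/
def cnotOp {V : Type*} [Fintype V] [DecidableEq V] (c t : V) : Op V :=
  Matrix.of fun a b => if a = Function.update b t (b t + b c) then 1 else 0

/-- The projectors on the eigenspaces `+1` and `-1` of a Pauli. -/
def projPlus {V : Type*} [Fintype V] [DecidableEq V] (Q : Pauli V) : Op V :=
  (1 / 2 : ℂ) • (1 + pauliOp Q)

def projMinus {V : Type*} [Fintype V] [DecidableEq V] (Q : Pauli V) : Op V :=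
  (1 / 2 : ℂ) • (1 - pauliOp Q)

/-- The channel of an instruction. Outcomes of measurements are summed over. A preparation resets
the qubit to `|+⟩` (`prepX`) or `|0⟩` (`prepZ`), written as a measurement that is followed by a flip
when the outcome is `-1`. -/
def Instr.chan {V : Type*} [Fintype V] [DecidableEq V] : Instr V → Op V → Op V
  | .prepX q, ρ =>
      projPlus (pauliX q) * ρ * projPlus (pauliX q) +
        pauliOp (pauliZ q) * (projMinus (pauliX q) * ρ * projMinus (pauliX q)) * pauliOp (pauliZ q)
  | .prepZ q, ρ =>
      projPlus (pauliZ q) * ρ * projPlus (pauliZ q) +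
        pauliOp (pauliX q) * (projMinus (pauliZ q) * ρ * projMinus (pauliZ q)) * pauliOp (pauliX q)
  | .cnot c t, ρ => cnotOp c t * ρ * (cnotOp c t)ᴴ
  | .measX q, ρ =>
      projPlus (pauliX q) * ρ * projPlus (pauliX q) +
        projMinus (pauliX q) * ρ * projMinus (pauliX q)
  | .measZ q, ρ =>
      projPlus (pauliZ q) * ρ * projPlus (pauliZ q) +
        projMinus (pauliZ q) * ρ * projMinus (pauliZ q)
  | .idle _, ρ => ρ

/-- Propagation of a Pauli fault through an instruction: conjugation by the CNOT, removal by a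
reset; a measurement leaves it in place. -/
def Instr.push {V : Type*} [DecidableEq V] : Instr V → Pauli V → Pauli V
  | .prepX q, Q => (Function.update Q.1 q 0, Function.update Q.2 q 0)
  | .prepZ q, Q => (Function.update Q.1 q 0, Function.update Q.2 q 0)
  | .cnot c t, Q =>
      (Function.update Q.1 t (Q.1 t + Q.1 c), Function.update Q.2 c (Q.2 c + Q.2 t))
  | .measX _, Q => Q
  | .measZ _, Q => Q
  | .idle _, Q => Q

/-- The channel of a circuit; the head of the list acts first. -/
def circuitChan {V : Type*} [Fintype V] [DecidableEq V] (c : List (Instr V)) (ρ : Op V) : Op V :=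
  c.foldl (fun r g => g.chan r) ρ

/-- Propagation of a Pauli fault through a circuit. -/
def circuitPush {V : Type*} [DecidableEq V] (c : List (Instr V)) (Q : Pauli V) : Pauli V :=
  c.foldl (fun P g => g.push P) Q

/-- The partial trace over the qubits of `W`. -/
def partialTrace {W D : Type*} [Fintype W] [DecidableEq W] (ρ : Op (W ⊕ D)) : Op D :=
  Matrix.of fun a b => ∑ c : W → Fin 2, ρ (Sum.elim c a) (Sum.elim c b)

/-- The factor of a Pauli on the qubits of `D`. -/
def dataPart {W D : Type*} (Q : Pauli (W ⊕ D)) : Pauli D :=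
  (fun d => Q.1 (Sum.inr d), fun d => Q.2 (Sum.inr d))

/-! ### Bivariate-bicycle codes and the depth-8 schedule -/

/-- The two ancilla registers `q(X)`, `q(Z)`. -/
inductive AncReg
  | X
  | Z
  deriving DecidableEq

instance : Fintype AncReg := ⟨{.X, .Z}, by rintro (_ | _) <;> simp⟩

/-- The two data registers `q(L)`, `q(R)`. -/
inductive DataReg
  | L
  | R
  deriving DecidableEq

instance : Fintype DataReg := ⟨{.L, .R}, by rintro (_ | _) <;> simp⟩

/-- The group `ℤ_ℓ × ℤ_m` of monomials `x^a y^b`, which indexes every register. -/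
abbrev Cell (ℓ m : ℕ) := ZMod ℓ × ZMod m

abbrev AncQubit (ℓ m : ℕ) := AncReg × Cell ℓ m

abbrev DataQubit (ℓ m : ℕ) := DataReg × Cell ℓ m

abbrev Qubit (ℓ m : ℕ) := AncQubit ℓ m ⊕ DataQubit ℓ m

instance (ℓ m : ℕ) : DecidableEq (Qubit ℓ m) := instDecidableEqSum

def qX {ℓ m : ℕ} (i : Cell ℓ m) : Qubit ℓ m := Sum.inl (AncReg.X, i)
def qZ {ℓ m : ℕ} (i : Cell ℓ m) : Qubit ℓ m := Sum.inl (AncReg.Z, i)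
def qL {ℓ m : ℕ} (i : Cell ℓ m) : Qubit ℓ m := Sum.inr (DataReg.L, i)
def qR {ℓ m : ℕ} (i : Cell ℓ m) : Qubit ℓ m := Sum.inr (DataReg.R, i)

/-- A bivariate-bicycle code: `A = A₁ + A₂ + A₃` and `B = B₁ + B₂ + B₃` with monomials `A_{k+1}` and
`B_{k+1}` given by their exponents `A k` and `B k`; `H_X = [A | B]`, `H_Z = [Bᵀ | Aᵀ]`. The
monomial with exponent `s` acts on indices by `i ↦ i + s`, its transpose by `i ↦ i - s`. -/
structure BBCode (ℓ m : ℕ) where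
  A : Fin 3 → Cell ℓ m
  B : Fin 3 → Cell ℓ m

/-- The given instructions for every index `i`. -/
def forAll {ℓ m : ℕ} [NeZero ℓ] [NeZero m] (f : Cell ℓ m → List (Instr (Qubit ℓ m))) :
    List (Instr (Qubit ℓ m)) :=
  (Finset.univ : Finset (Cell ℓ m)).toList.flatMap f

/-- The rounds `1, …, 8` of the depth-8 syndrome-extraction cycle. -/
def BBCode.round {ℓ m : ℕ} [NeZero ℓ] [NeZero m] (C : BBCode ℓ m) : ℕ → List (Instr (Qubit ℓ m))
  | 1 => forAll fun i => [.prepX (qX i), .cnot (qR (i - C.A 0)) (qZ i), .idle (qL i)]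
  | 2 => forAll fun i => [.cnot (qX i) (qL (i + C.A 1)), .cnot (qR (i - C.A 2)) (qZ i)]
  | 3 => forAll fun i => [.cnot (qX i) (qR (i + C.B 1)), .cnot (qL (i - C.B 0)) (qZ i)]
  | 4 => forAll fun i => [.cnot (qX i) (qR (i + C.B 0)), .cnot (qL (i - C.B 1)) (qZ i)]
  | 5 => forAll fun i => [.cnot (qX i) (qR (i + C.B 2)), .cnot (qL (i - C.B 2)) (qZ i)]
  | 6 => forAll fun i => [.cnot (qX i) (qL (i + C.A 0)), .cnot (qR (i - C.A 1)) (qZ i)]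
  | 7 => forAll fun i => [.cnot (qX i) (qL (i + C.A 2)), .measZ (qZ i), .idle (qR i)]
  | 8 => forAll fun i => [.measX (qX i), .prepZ (qZ i), .idle (qL i), .idle (qR i)]
  | _ => []

/-- The three `B` rounds. -/
def bRounds : Finset ℕ := {3, 4, 5}

/-- The part of the cycle that follows a fault in round `t`: the rounds after `t`, and the
instructions of round `t` itself if the fault is placed before its gates (`pre = true`). -/
def BBCode.remaining {ℓ m : ℕ} [NeZero ℓ] [NeZero m] (C : BBCode ℓ m) (pre : Bool) (t : ℕ) :
    List (Instr (Qubit ℓ m)) :=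
  (if pre then C.round t else []) ++ (List.range' (t + 1) (8 - t)).flatMap C.round

/-- The rest of the cycle followed by ancilla elimination, as a map from operators on all qubits to
operators on the data qubits. -/
def BBCode.toData {ℓ m : ℕ} [NeZero ℓ] [NeZero m] (C : BBCode ℓ m) (pre : Bool) (t : ℕ)
    (ρ : Op (Qubit ℓ m)) : Op (DataQubit ℓ m) :=
  partialTrace (circuitChan (C.remaining pre t) ρ)

/-- The data Pauli to which a Pauli fault in round `t` propagates. -/
def BBCode.propagate {ℓ m : ℕ} [NeZero ℓ] [NeZero m] (C : BBCode ℓ m) (pre : Bool) (t : ℕ)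
    (Q : Pauli (Qubit ℓ m)) : Pauli (DataQubit ℓ m) :=
  dataPart (circuitPush (C.remaining pre t) Q)

/-! ### Gate blocks and CSS sectors -/

/-- A gate block: the two qubits (control, target) of a CNOT. -/
abbrev Block (ℓ m : ℕ) := Qubit ℓ m × Qubit ℓ m

instance (ℓ m : ℕ) : DecidableEq (Block ℓ m) := instDecidableEqProd

/-- The set `E_t` of gate blocks that are active in round `t`. -/
def BBCode.activeBlocks {ℓ m : ℕ} [NeZero ℓ] [NeZero m] (C : BBCode ℓ m) (t : ℕ) :
    Finset (Block ℓ m) :=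
  open Classical in Finset.univ.filter fun e => Instr.cnot e.1 e.2 ∈ C.round t

inductive Sector
  | X
  | Z
  deriving DecidableEq

/-- The block is sector-relevant: a `q(L) → q(Z)` CNOT in the `X` sector, a `q(X) → q(R)` CNOT in
the `Z` sector. -/
def IsRelevant {ℓ m : ℕ} : Sector → Block ℓ m → Prop
  | .X, (Sum.inr (.L, _), Sum.inl (.Z, _)) => True
  | .Z, (Sum.inl (.X, _), Sum.inr (.R, _)) => True
  | _, _ => False

/-- The block Pauli `P_e`: `X_data ⊗ I_anc` on a `q(L) → q(Z)` block and `Z_anc ⊗ Z_data` on a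
`q(X) → q(R)` block. No other blocks are active in the `B` rounds. -/
def blockPauli {ℓ m : ℕ} : Block ℓ m → Pauli (Qubit ℓ m)
  | (Sum.inr (.L, i), Sum.inl (.Z, _)) => pauliX (qL i)
  | (Sum.inl (.X, i), Sum.inr (.R, j)) => pauliZ (qX i) + pauliZ (qR j)
  | _ => 0

/-- The data register that carries the faults of the sector. -/
def Sector.reg : Sector → DataReg
  | .X => .L
  | .Z => .R

/-- The Pauli of the sector on one data qubit. -/
def Sector.pauliAt {ℓ m : ℕ} (σ : Sector) (d : DataQubit ℓ m) : Pauli (DataQubit ℓ m) :=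
  match σ with
  | .X => pauliX d
  | .Z => pauliZ d

/-- Restriction of a Pauli to its `X`-type or `Z`-type part. -/
def Sector.restrict {V : Type*} (σ : Sector) (P : Pauli V) : Pauli V :=
  match σ with
  | .X => (P.1, 0)
  | .Z => (0, P.2)

/-! ### Routed geometry and the tick Hamiltonian -/

/-- A routed embedding: qubit positions in space and a routed curve for every gate block. -/
structure RoutedEmbedding (ℓ m : ℕ) where
  pos : Qubit ℓ m → EuclideanSpace ℝ (Fin 3)
  route : (e : Block ℓ m) → Path (pos e.1) (pos e.2)

/-- The routed separation `d_φ(e, e')`: the closest approach of the two curves. -/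
def RoutedEmbedding.sep {ℓ m : ℕ} (φ : RoutedEmbedding ℓ m) (e e' : Block ℓ m) : ℝ :=
  ⨅ p : unitInterval × unitInterval, dist (φ.route e p.1) (φ.route e' p.2)

theorem RoutedEmbedding.sep_comm {ℓ m : ℕ} (φ : RoutedEmbedding ℓ m) (e e' : Block ℓ m) :
    φ.sep e e' = φ.sep e' e := by
  unfold RoutedEmbedding.sep
  refine (Equiv.prodComm unitInterval unitInterval).iInf_congr fun p => ?_
  exact dist_comm _ _

/-- A proximity kernel, as a function of the separation `d ≥ 0`. -/
structure ProximityKernel where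
  toFun : ℝ → ℝ
  nonneg : ∀ d, 0 ≤ d → 0 ≤ toFun d
  antitone : AntitoneOn toFun (Set.Ici 0)
  map_zero : toFun 0 = 1

/-- The set `A_t` of unordered pairs of distinct blocks of `E`. -/
def blockPairs {ℓ m : ℕ} [NeZero ℓ] [NeZero m] (E : Finset (Block ℓ m)) :
    Finset (Sym2 (Block ℓ m)) :=
  E.sym2.filter fun a => ¬ a.IsDiag

/-- The pair event `S_a = P_e ⊗ P_{e'}` for `a = {e, e'}`. -/
def pairPauli {ℓ m : ℕ} (a : Sym2 (Block ℓ m)) : Pauli (Qubit ℓ m) :=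
  Sym2.lift ⟨fun e e' => blockPauli e + blockPauli e', fun _ _ => add_comm _ _⟩ a

/-- The coupling data: routed embedding, kernel, coupling scale `J₀ > 0`, tick duration `τ > 0`. -/
structure Geometry (ℓ m : ℕ) where
  φ : RoutedEmbedding ℓ m
  κ : ProximityKernel
  J₀ : ℝ
  τ : ℝ
  J₀_pos : 0 < J₀
  τ_pos : 0 < τ

/-- The kernel value `κ(d_φ(e, e'))` of a pair. -/
def Geometry.kappa {ℓ m : ℕ} (g : Geometry ℓ m) (a : Sym2 (Block ℓ m)) : ℝ :=
  g.κ.toFun (Sym2.lift ⟨fun e e' => g.φ.sep e e', g.φ.sep_comm⟩ a)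

/-- The pair phase `θ_a = τ J₀ κ(d_φ(e, e'))`. -/
def Geometry.theta {ℓ m : ℕ} (g : Geometry ℓ m) (a : Sym2 (Block ℓ m)) : ℝ :=
  g.τ * g.J₀ * g.kappa a

/-- The tickwise coupling norm `Θ_t`, with `Θ_t² = ∑_a θ_a²`. -/
def Geometry.Theta {ℓ m : ℕ} [NeZero ℓ] [NeZero m] (g : Geometry ℓ m) (E : Finset (Block ℓ m)) :
    ℝ :=
  Real.sqrt (∑ a ∈ blockPairs E, g.theta a ^ 2)

/-- The tickwise geometry Hamiltonian `J₀ ∑_{e,e'} κ(d_φ(e, e')) P_e ⊗ P_{e'}`. -/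
def Geometry.hamiltonian {ℓ m : ℕ} [NeZero ℓ] [NeZero m] (g : Geometry ℓ m)
    (E : Finset (Block ℓ m)) : Op (Qubit ℓ m) :=
  (g.J₀ : ℂ) • ∑ a ∈ blockPairs E, (g.kappa a : ℂ) • pauliOp (pairPauli a)

/-- The same-tick unitary `U_t = exp(-i τ H)`. -/
def Geometry.unitary {ℓ m : ℕ} [NeZero ℓ] [NeZero m] (g : Geometry ℓ m)
    (E : Finset (Block ℓ m)) : Op (Qubit ℓ m) :=
  NormedSpace.exp ((-Complex.I * (g.τ : ℂ)) • g.hamiltonian E)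

/-- The same-tick channel `ρ ↦ U_t ρ U_t†`. -/
def Geometry.chan {ℓ m : ℕ} [NeZero ℓ] [NeZero m] (g : Geometry ℓ m)
    (E : Finset (Block ℓ m)) (ρ : Op (Qubit ℓ m)) : Op (Qubit ℓ m) :=
  g.unitary E * ρ * (g.unitary E)ᴴ

/-! ### The data channel and the discarded mass -/

/-- The probability of the data Pauli `P` in the twirled data channel: the total probability of the
Paulis of the twirled tick channel that propagate to `P`. -/
def dataProb {ℓ m : ℕ} [NeZero ℓ] [NeZero m] (C : BBCode ℓ m) (g : Geometry ℓ m) (pre : Bool)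
    (t : ℕ) (E : Finset (Block ℓ m)) (P : Pauli (DataQubit ℓ m)) : ℝ :=
  ∑ Q : Pauli (Qubit ℓ m), if C.propagate pre t Q = P then twirlProb (g.unitary E) Q else 0

/-- The probability of `P` after restriction to the sector `σ`. -/
def sectorProb {ℓ m : ℕ} [NeZero ℓ] [NeZero m] (C : BBCode ℓ m) (g : Geometry ℓ m) (pre : Bool)
    (t : ℕ) (E : Finset (Block ℓ m)) (σ : Sector) (P : Pauli (DataQubit ℓ m)) : ℝ :=
  ∑ D : Pauli (DataQubit ℓ m), if σ.restrict D = P then dataProb C g pre t E D else 0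

/-- The discarded mass `M_{≥3}^σ(φ)`. -/
def discardedMass {ℓ m : ℕ} [NeZero ℓ] [NeZero m] (C : BBCode ℓ m) (g : Geometry ℓ m) (pre : Bool)
    (t : ℕ) (E : Finset (Block ℓ m)) (σ : Sector) : ℝ :=
  ∑ P : Pauli (DataQubit ℓ m), if 3 ≤ pauliWt P then sectorProb C g pre t E σ P else 0

/-- `Pr[N ≥ 2]` for `N = ∑_a Y_a` with independent `Y_a ∼ Bernoulli(sin² θ_a)`, `a ∈ A_t`: the sum
over the sets `B = {a | Y_a = 1}` with at least two elements. -/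
def probTwoOrMore {ℓ m : ℕ} [NeZero ℓ] [NeZero m] (g : Geometry ℓ m) (E : Finset (Block ℓ m)) : ℝ :=
  ∑ B ∈ (blockPairs E).powerset.filter (fun B => 2 ≤ B.card),
    (∏ a ∈ B, Real.sin (g.theta a) ^ 2) *
      ∏ a ∈ blockPairs E \ B, (1 - Real.sin (g.theta a) ^ 2)

/-- The collision multiplicity `m_t = max_Q |{B ⊆ A_t : S_B = Q, |B| ≥ 2}|`. -/
def collisionMult {ℓ m : ℕ} [NeZero ℓ] [NeZero m] (E : Finset (Block ℓ m)) : ℕ :=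
  (Finset.univ : Finset (Pauli (Qubit ℓ m))).sup fun Q =>
    ((blockPairs E).powerset.filter fun B => ∑ a ∈ B, pairPauli a = Q ∧ 2 ≤ B.card).card

end BBSchedule

end

/-! Conjugation by a Pauli can be moved through the whole cycle. A CNOT is Clifford, a measurement
summed over its outcomes does not notice which outcome a fault flips, a reset absorbs whatever acts
on its qubit, and the partial trace drops the ancilla factor (`Instr.chan_conj`,
`partialTrace_conj`). The block Paulis have no `X` part on the `X` ancillas and no `Z` part on the
`Z` ancillas, so no later CNOT copies anything onto the data (`Instr.push_of_isNonspreading`). A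
pair event therefore ends as its own data factor, and distinct blocks of a `B` round touch distinct
data qubits, whence weight exactly 2.

For the mass bound, the block Paulis are `X` on `q(L)` and `Z` elsewhere, so they commute and
multiply without phases. Hence `U_t` is the product of the factors `cos θ_a - i sin θ_a S_a`, and
the set `B` of chosen events has an amplitude whose squared modulus is the probability of the
Bernoulli pattern `B` (`exp_sum_pauliOp`, `norm_sq_amplitude`). Twirling removes the interference
between different Paulis (`pauliTwirl_sum`), but sets with the same product still interfere;
Cauchy–Schwarz pays for this with the collision multiplicity (`sum_norm_sq_pauliAmplitude_le`). At
most one event gives data weight at most 2, so weight at least 3 needs two events. Finally `Pr[N ≥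
2]` is at most half the square of the mean of `N`, and `sin² θ ≤ θ²`. -/

namespace BBSchedule

/-! ### Tensor products of one-qubit operators -/

section Tensor

variable {V : Type*} [Fintype V] [DecidableEq V]

/-- The tensor product of a family of one-qubit operators. -/
def tensorOp (M : V → Matrix (Fin 2) (Fin 2) ℂ) : Op V :=
  Matrix.of fun a b => ∏ v, M v (a v) (b v)

omit [DecidableEq V] in
theorem pauliOp_eq_tensorOp (Q : Pauli V) :
    pauliOp Q = tensorOp fun v => pauliMatrix (Q.1 v) (Q.2 v) := rfl

/-- Distributivity: a product over qubits of sums over an intermediate bit is a sum over all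
intermediate bit strings. -/
theorem tensorOp_mul (M N : V → Matrix (Fin 2) (Fin 2) ℂ) :
    tensorOp M * tensorOp N = tensorOp fun v => M v * N v := by
  ext a b
  simp only [tensorOp, Matrix.mul_apply, Matrix.of_apply, ← Finset.prod_mul_distrib]
  rw [Finset.prod_univ_sum, Fintype.piFinset_univ]

theorem trace_tensorOp (M : V → Matrix (Fin 2) (Fin 2) ℂ) :
    (tensorOp M).trace = ∏ v, (M v).trace := by
  simp only [tensorOp, Matrix.trace, Matrix.diag, Matrix.of_apply]
  rw [Finset.prod_univ_sum, Fintype.piFinset_univ]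

omit [DecidableEq V] in
theorem tensorOp_smul (c : V → ℂ) (M : V → Matrix (Fin 2) (Fin 2) ℂ) :
    (tensorOp fun v => c v • M v) = (∏ v, c v) • tensorOp M := by
  ext a b
  simp [tensorOp, Finset.prod_mul_distrib]

omit [DecidableEq V] in
theorem tensorOp_one : tensorOp (fun _ : V => (1 : Matrix (Fin 2) (Fin 2) ℂ)) = 1 := by
  ext a b
  simp only [tensorOp, Matrix.of_apply, Matrix.one_apply, Finset.prod_ite_zero]
  simp [funext_iff]

omit [DecidableEq V] in
theorem conjTranspose_tensorOp (M : V → Matrix (Fin 2) (Fin 2) ℂ) :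
    (tensorOp M)ᴴ = tensorOp fun v => (M v)ᴴ := by
  ext a b
  simp [tensorOp, Matrix.conjTranspose_apply]

end Tensor

/-! ### One-qubit Pauli matrices -/

theorem zmod_two_cases (x : ZMod 2) : x = 0 ∨ x = 1 := by
  revert x; decide

theorem pauliMatrix_zero : pauliMatrix 0 0 = 1 := by
  simp [pauliMatrix, Matrix.one_fin_two]

theorem conjTranspose_pauliMatrix (x z : ZMod 2) : (pauliMatrix x z)ᴴ = pauliMatrix x z := by
  obtain rfl | rfl := zmod_two_cases x <;> obtain rfl | rfl := zmod_two_cases z <;>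
  · ext i j; fin_cases i <;> fin_cases j <;> simp [pauliMatrix]

theorem pauliMatrix_mul_self (x z : ZMod 2) : pauliMatrix x z * pauliMatrix x z = 1 := by
  obtain rfl | rfl := zmod_two_cases x <;> obtain rfl | rfl := zmod_two_cases z <;>
  simp [pauliMatrix, Matrix.one_fin_two]

/-- The sign in the commutation of two one-qubit Paulis. -/
def localSign (x z x' z' : ZMod 2) : ℤ := if x * z' + z * x' = 0 then 1 else -1

theorem pauliMatrix_mul_comm (x z x' z' : ZMod 2) :
    pauliMatrix x z * pauliMatrix x' z' =
      (localSign x z x' z' : ℂ) • (pauliMatrix x' z' * pauliMatrix x z) := by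
  obtain rfl | rfl := zmod_two_cases x <;> obtain rfl | rfl := zmod_two_cases z <;>
  obtain rfl | rfl := zmod_two_cases x' <;> obtain rfl | rfl := zmod_two_cases z' <;>
  simp [pauliMatrix, localSign, CharTwo.add_self_eq_zero]

theorem trace_pauliMatrix_mul (x z x' z' : ZMod 2) :
    (pauliMatrix x z * pauliMatrix x' z').trace = if x = x' ∧ z = z' then 2 else 0 := by
  obtain rfl | rfl := zmod_two_cases x <;> obtain rfl | rfl := zmod_two_cases z <;>
  obtain rfl | rfl := zmod_two_cases x' <;> obtain rfl | rfl := zmod_two_cases z' <;>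
  simp [pauliMatrix, Matrix.trace_fin_two] <;> norm_num

theorem exists_pauliMatrix_mul (x z x' z' : ZMod 2) : ∃ c : ℂ, star c * c = 1 ∧
    pauliMatrix x z * pauliMatrix x' z' = c • pauliMatrix (x + x') (z + z') := by
  obtain rfl | rfl := zmod_two_cases x <;> obtain rfl | rfl := zmod_two_cases z <;>
  obtain rfl | rfl := zmod_two_cases x' <;> obtain rfl | rfl := zmod_two_cases z' <;>
  first
  | (refine ⟨1, ?_, ?_⟩ <;> simp [pauliMatrix, CharTwo.add_self_eq_zero]; done)
  | (refine ⟨Complex.I, ?_, ?_⟩ <;> simp [pauliMatrix, CharTwo.add_self_eq_zero]; done)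
  | (refine ⟨-Complex.I, ?_, ?_⟩ <;> simp [pauliMatrix, CharTwo.add_self_eq_zero])

/-- Phases arise only when `X` meets `Z` on the same qubit; this is the local reason why products of
block Paulis carry none. -/
theorem pauliMatrix_mul_of_same_type (x z x' z' : ZMod 2)
    (h : (z = 0 ∧ z' = 0) ∨ (x = 0 ∧ x' = 0)) :
    pauliMatrix x z * pauliMatrix x' z' = pauliMatrix (x + x') (z + z') := by
  rcases h with ⟨rfl, rfl⟩ | ⟨rfl, rfl⟩
  · obtain rfl | rfl := zmod_two_cases x <;> obtain rfl | rfl := zmod_two_cases x' <;>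
    simp [pauliMatrix, CharTwo.add_self_eq_zero]
  · obtain rfl | rfl := zmod_two_cases z <;> obtain rfl | rfl := zmod_two_cases z' <;>
    simp [pauliMatrix, CharTwo.add_self_eq_zero]

/-! ### Pauli operators -/

section PauliOp

variable {V : Type*} [Fintype V] [DecidableEq V]

omit [DecidableEq V] in
theorem pauliOp_zero : pauliOp (0 : Pauli V) = 1 := by
  simp [pauliOp_eq_tensorOp, pauliMatrix_zero, tensorOp_one]

omit [DecidableEq V] in
theorem conjTranspose_pauliOp (Q : Pauli V) : (pauliOp Q)ᴴ = pauliOp Q := by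
  simp [pauliOp_eq_tensorOp, conjTranspose_tensorOp, conjTranspose_pauliMatrix]

theorem pauliOp_mul_self (Q : Pauli V) : pauliOp Q * pauliOp Q = 1 := by
  simp [pauliOp_eq_tensorOp, tensorOp_mul, pauliMatrix_mul_self, tensorOp_one]

/-- The sign in the commutation of two Paulis. -/
def commSign (Q R : Pauli V) : ℤ := ∏ v, localSign (Q.1 v) (Q.2 v) (R.1 v) (R.2 v)

theorem pauliOp_mul_comm (Q R : Pauli V) :
    pauliOp Q * pauliOp R = (commSign Q R : ℂ) • (pauliOp R * pauliOp Q) := by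
  simp only [pauliOp_eq_tensorOp, tensorOp_mul]
  simp_rw [fun v => pauliMatrix_mul_comm (Q.1 v) (Q.2 v) (R.1 v) (R.2 v)]
  rw [tensorOp_smul]
  simp [commSign]

omit [DecidableEq V] in
theorem commSign_eq_or (Q R : Pauli V) : commSign Q R = 1 ∨ commSign Q R = -1 := by
  unfold commSign
  refine Finset.prod_induction _ (fun k : ℤ => k = 1 ∨ k = -1) ?_ (Or.inl rfl) ?_
  · rintro a b (rfl | rfl) (rfl | rfl) <;> simp
  · intro v _
    unfold localSign
    split_ifs <;> simp

omit [DecidableEq V] in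
theorem commSign_mul_self (Q R : Pauli V) : commSign Q R * commSign Q R = 1 := by
  rcases commSign_eq_or Q R with h | h <;> simp [h]

theorem trace_pauliOp_mul (Q R : Pauli V) :
    (pauliOp Q * pauliOp R).trace = if Q = R then (2 : ℂ) ^ Fintype.card V else 0 := by
  simp only [pauliOp_eq_tensorOp, tensorOp_mul, trace_tensorOp, trace_pauliMatrix_mul,
    Finset.prod_ite_zero, Finset.prod_const, Finset.card_univ]
  congr 1
  simp [Prod.ext_iff, funext_iff, forall_and]

/-- The value of the phase is immaterial: it only has to cancel against its conjugate in two-sided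
conjugation. -/
theorem exists_pauliOp_mul (Q R : Pauli V) :
    ∃ c : ℂ, star c * c = 1 ∧ pauliOp Q * pauliOp R = c • pauliOp (Q + R) := by
  choose c hc h using fun v => exists_pauliMatrix_mul (Q.1 v) (Q.2 v) (R.1 v) (R.2 v)
  refine ⟨∏ v, c v, ?_, ?_⟩
  · rw [star_prod, ← Finset.prod_mul_distrib]
    exact Finset.prod_eq_one fun v _ => hc v
  · simp only [pauliOp_eq_tensorOp, tensorOp_mul, h, tensorOp_smul]
    rfl

/-- Conjugation by Paulis is an action of the group of Paulis modulo phases. -/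
theorem pauliOp_add_conj (Q R : Pauli V) (ρ : Op V) :
    pauliOp (Q + R) * ρ * pauliOp (Q + R) =
      pauliOp Q * (pauliOp R * ρ * pauliOp R) * pauliOp Q := by
  obtain ⟨c, hc, h⟩ := exists_pauliOp_mul Q R
  have h' : pauliOp R * pauliOp Q = star c • pauliOp (Q + R) := by
    have := congrArg Matrix.conjTranspose h
    simpa [Matrix.conjTranspose_mul, conjTranspose_pauliOp] using this
  calc pauliOp (Q + R) * ρ * pauliOp (Q + R)
      = (star c * c) • (pauliOp (Q + R) * ρ * pauliOp (Q + R)) := by rw [hc, one_smul]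
    _ = (c • pauliOp (Q + R)) * ρ * (star c • pauliOp (Q + R)) := by
        simp [smul_smul]
    _ = pauliOp Q * (pauliOp R * ρ * pauliOp R) * pauliOp Q := by
        rw [← h, ← h']; simp only [mul_assoc]

/-- Paulis that are purely of `X` type on `s` and purely of `Z` type off `s`. -/
def splitPaulis (s : Set V) : AddSubgroup (Pauli V) where
  carrier := {Q | (∀ v ∈ s, Q.2 v = 0) ∧ ∀ v ∉ s, Q.1 v = 0}
  zero_mem' := by simp
  add_mem' := by
    rintro P Q ⟨h1, h2⟩ ⟨h3, h4⟩
    exact ⟨fun v hv => by simp [h1 v hv, h3 v hv], fun v hv => by simp [h2 v hv, h4 v hv]⟩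
  neg_mem' := by
    rintro P ⟨h1, h2⟩
    exact ⟨fun v hv => by simp [h1 v hv], fun v hv => by simp [h2 v hv]⟩

theorem pauliOp_mul_of_mem_splitPaulis {s : Set V} {Q R : Pauli V} (hQ : Q ∈ splitPaulis s)
    (hR : R ∈ splitPaulis s) : pauliOp Q * pauliOp R = pauliOp (Q + R) := by
  simp only [pauliOp_eq_tensorOp, tensorOp_mul]
  congr 1
  funext v
  apply pauliMatrix_mul_of_same_type
  by_cases hv : v ∈ s
  · exact Or.inl ⟨hQ.1 v hv, hR.1 v hv⟩
  · exact Or.inr ⟨hQ.2 v hv, hR.2 v hv⟩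

theorem pauliOp_conj_pauliOp (R Q : Pauli V) :
    pauliOp R * pauliOp Q * pauliOp R = (commSign R Q : ℂ) • pauliOp Q := by
  rw [pauliOp_mul_comm, smul_mul_assoc, mul_assoc, pauliOp_mul_self, mul_one]

theorem pauliOp_ne_zero (Q : Pauli V) : pauliOp Q ≠ 0 := by
  intro h
  have h1 := trace_pauliOp_mul Q Q
  rw [h, if_pos rfl, zero_mul, Matrix.trace_zero] at h1
  exact pow_ne_zero _ two_ne_zero h1.symm

/-- Conjugating `Q` by `R + R'` at once or in two steps gives the same multiple of a nonzero
operator. Thus `R ↦ commSign R Q` is a character. -/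
theorem commSign_add_left (R R' Q : Pauli V) :
    commSign (R + R') Q = commSign R Q * commSign R' Q := by
  have h : (commSign (R + R') Q : ℂ) • pauliOp Q =
      ((commSign R Q * commSign R' Q : ℤ) : ℂ) • pauliOp Q := by
    rw [← pauliOp_conj_pauliOp, pauliOp_add_conj, pauliOp_conj_pauliOp, mul_smul_comm,
      smul_mul_assoc, pauliOp_conj_pauliOp, smul_smul, mul_comm]
    push_cast; rfl
  exact_mod_cast smul_left_injective ℂ (pauliOp_ne_zero Q) h

theorem commSign_pauliX (v : V) (Q : Pauli V) :
    commSign (pauliX v) Q = if Q.2 v = 0 then 1 else -1 := by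
  unfold commSign
  rw [Finset.prod_eq_single v]
  · simp [pauliX, localSign]
  · intro w _ hw; simp [pauliX, localSign, hw]
  · simp

theorem commSign_pauliZ (v : V) (Q : Pauli V) :
    commSign (pauliZ v) Q = if Q.1 v = 0 then 1 else -1 := by
  unfold commSign
  rw [Finset.prod_eq_single v]
  · simp [pauliZ, localSign]
  · intro w _ hw; simp [pauliZ, localSign, hw]
  · simp

theorem ite_mul_ite_of_ne {x y : ZMod 2} (h : x ≠ y) :
    (if x = 0 then (1 : ℤ) else -1) * (if y = 0 then 1 else -1) = -1 := by
  revert x y; decide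

theorem exists_commSign_mul_eq_neg_one {Q Q' : Pauli V} (h : Q ≠ Q') :
    ∃ R : Pauli V, commSign R Q * commSign R Q' = -1 := by
  by_cases hx : Q.1 = Q'.1
  · have hz : Q.2 ≠ Q'.2 := fun hz => h (Prod.ext hx hz)
    obtain ⟨v, hv⟩ := Function.ne_iff.1 hz
    exact ⟨pauliX v, by rw [commSign_pauliX, commSign_pauliX, ite_mul_ite_of_ne hv]⟩
  · obtain ⟨v, hv⟩ := Function.ne_iff.1 hx
    exact ⟨pauliZ v, by rw [commSign_pauliZ, commSign_pauliZ, ite_mul_ite_of_ne hv]⟩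

/-- Orthogonality of the characters `R ↦ commSign R Q`. -/
theorem sum_commSign_mul (Q Q' : Pauli V) :
    ∑ R : Pauli V, commSign R Q * commSign R Q' =
      if Q = Q' then (4 : ℤ) ^ Fintype.card V else 0 := by
  split_ifs with h
  · subst h
    simp only [commSign_mul_self, Finset.sum_const, Finset.card_univ, Fintype.card_prod,
      Fintype.card_fun, ZMod.card]
    simp only [nsmul_eq_mul, mul_one]
    push_cast
    rw [← mul_pow]; norm_num
  -- Translating the summation variable by `R₀` negates every term, so the sum equals its own
  -- negative.
  · obtain ⟨R₀, hR₀⟩ := exists_commSign_mul_eq_neg_one h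
    have := Equiv.sum_comp (Equiv.addRight R₀) fun R : Pauli V => commSign R Q * commSign R Q'
    simp only [Equiv.coe_addRight, commSign_add_left] at this
    have h2 : ∀ R : Pauli V, commSign R Q * commSign R₀ Q * (commSign R Q' * commSign R₀ Q') =
        -(commSign R Q * commSign R Q') := fun R => by
      rw [mul_mul_mul_comm, hR₀, mul_neg_one]
    simp only [h2, Finset.sum_neg_distrib] at this
    linarith

end PauliOp

/-! ### Propagation of Paulis through instructions -/

section Propagation

variable {V : Type*} [Fintype V] [DecidableEq V]

/-- Two Paulis commute or anticommute. -/
theorem pauliOp_commute_or (Q R : Pauli V) :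
    pauliOp Q * pauliOp R = pauliOp R * pauliOp Q ∨
      pauliOp Q * pauliOp R = -(pauliOp R * pauliOp Q) := by
  rcases commSign_eq_or Q R with h | h
  · left; rw [pauliOp_mul_comm, h]; simp
  · right; rw [pauliOp_mul_comm, h]; simp

theorem projPlus_mul_of_commute {Q M : Pauli V}
    (h : pauliOp Q * pauliOp M = pauliOp M * pauliOp Q) :
    projPlus M * pauliOp Q = pauliOp Q * projPlus M := by
  simp [projPlus, mul_add, add_mul, h]

theorem projMinus_mul_of_commute {Q M : Pauli V}
    (h : pauliOp Q * pauliOp M = pauliOp M * pauliOp Q) :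
    projMinus M * pauliOp Q = pauliOp Q * projMinus M := by
  simp [projMinus, mul_sub, sub_mul, h]

theorem projPlus_mul_of_anticommute {Q M : Pauli V}
    (h : pauliOp Q * pauliOp M = -(pauliOp M * pauliOp Q)) :
    projPlus M * pauliOp Q = pauliOp Q * projMinus M := by
  simp [projPlus, projMinus, mul_sub, add_mul, h]

theorem projMinus_mul_of_anticommute {Q M : Pauli V}
    (h : pauliOp Q * pauliOp M = -(pauliOp M * pauliOp Q)) :
    projMinus M * pauliOp Q = pauliOp Q * projPlus M := by
  simp only [projPlus, projMinus, mul_add, sub_mul, h, smul_mul_assoc, mul_smul_comm, one_mul,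
    mul_one, ← sub_eq_add_neg]

theorem projPlus_mul_pauliOp (M : Pauli V) : projPlus M * pauliOp M = projPlus M := by
  simp [projPlus, add_mul, pauliOp_mul_self, add_comm]

theorem projMinus_mul_pauliOp (M : Pauli V) : projMinus M * pauliOp M = -projMinus M := by
  simp [projMinus, sub_mul, pauliOp_mul_self, ← smul_neg]

theorem conjTranspose_projPlus (M : Pauli V) : (projPlus M)ᴴ = projPlus M := by
  simp [projPlus, Matrix.conjTranspose_smul, conjTranspose_pauliOp]

theorem conjTranspose_projMinus (M : Pauli V) : (projMinus M)ᴴ = projMinus M := by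
  simp [projMinus, Matrix.conjTranspose_smul, conjTranspose_pauliOp]

/-- The adjoint form of an exchange relation between Hermitian operators. -/
theorem exchange_adjoint {A B K K' : Op V} (hA : Aᴴ = A) (hB : Bᴴ = B) (hK : Kᴴ = K)
    (hK' : K'ᴴ = K') (h : K * A = B * K') : A * K = K' * B := by
  have := congrArg Matrix.conjTranspose h
  simpa [Matrix.conjTranspose_mul, hA, hB, hK, hK'] using this

theorem sandwich_exchange {A A' B B' K K' L L' : Op V} (h : K * A = B * K') (h' : A' * L = L' * B')
    (ρ : Op V) : K * (A * ρ * A') * L = B * (K' * ρ * L') * B' := by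
  calc K * (A * ρ * A') * L = (K * A) * ρ * (A' * L) := by simp only [mul_assoc]
    _ = B * (K' * ρ * L') * B' := by rw [h, h']; simp only [mul_assoc]

/-- The non-selective measurement of a Pauli. -/
noncomputable def measureChan (M : Pauli V) (ρ : Op V) : Op V :=
  projPlus M * ρ * projPlus M + projMinus M * ρ * projMinus M

/-- The reset to the `+1` eigenspace of `M`, with the flip `F`. -/
noncomputable def resetChan (M F : Pauli V) (ρ : Op V) : Op V :=
  projPlus M * ρ * projPlus M +
    pauliOp F * (projMinus M * ρ * projMinus M) * pauliOp F

/-- A commuting Pauli passes each projector; an anticommuting one swaps the two, and the sum over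
outcomes is symmetric in them. -/
theorem measureChan_conj (M Q : Pauli V) (ρ : Op V) :
    measureChan M (pauliOp Q * ρ * pauliOp Q) = pauliOp Q * measureChan M ρ * pauliOp Q := by
  have hQ := conjTranspose_pauliOp Q
  have hp := conjTranspose_projPlus M
  have hm := conjTranspose_projMinus M
  unfold measureChan
  rcases pauliOp_commute_or Q M with h | h
  · have h1 := projPlus_mul_of_commute h
    have h2 := projMinus_mul_of_commute h
    rw [sandwich_exchange h1 (exchange_adjoint hQ hQ hp hp h1),
      sandwich_exchange h2 (exchange_adjoint hQ hQ hm hm h2), mul_add, add_mul]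
  · have h1 := projPlus_mul_of_anticommute h
    have h2 := projMinus_mul_of_anticommute h
    rw [sandwich_exchange h1 (exchange_adjoint hQ hQ hp hm h1),
      sandwich_exchange h2 (exchange_adjoint hQ hQ hm hp h2), mul_add, add_mul, add_comm]

theorem resetChan_conj_of_commute {M F Q : Pauli V} (ρ : Op V)
    (hM : pauliOp Q * pauliOp M = pauliOp M * pauliOp Q)
    (hF : pauliOp Q * pauliOp F = pauliOp F * pauliOp Q) :
    resetChan M F (pauliOp Q * ρ * pauliOp Q) = pauliOp Q * resetChan M F ρ * pauliOp Q := by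
  have hQ := conjTranspose_pauliOp Q
  have h1 := projPlus_mul_of_commute hM
  have h2 := projMinus_mul_of_commute hM
  unfold resetChan
  rw [sandwich_exchange h1 (exchange_adjoint hQ hQ (conjTranspose_projPlus M)
      (conjTranspose_projPlus M) h1),
    sandwich_exchange h2 (exchange_adjoint hQ hQ (conjTranspose_projMinus M)
      (conjTranspose_projMinus M) h2), sandwich_exchange hF.symm hF, mul_add, add_mul]

/-- `M` acts as a scalar `±1` on each eigenspace, and the scalar occurs once on each side. -/
theorem resetChan_conj_self (M F : Pauli V) (ρ : Op V) :
    resetChan M F (pauliOp M * ρ * pauliOp M) = resetChan M F ρ := by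
  have hM := conjTranspose_pauliOp M
  have h1 : projPlus M * pauliOp M = 1 * projPlus M := by
    rw [projPlus_mul_pauliOp, one_mul]
  have h2 : projMinus M * pauliOp M = (-1) * projMinus M := by
    rw [projMinus_mul_pauliOp, neg_one_mul]
  unfold resetChan
  rw [sandwich_exchange h1 (exchange_adjoint hM (by simp) (conjTranspose_projPlus M)
      (conjTranspose_projPlus M) h1),
    sandwich_exchange h2 (exchange_adjoint hM (by simp) (conjTranspose_projMinus M)
      (conjTranspose_projMinus M) h2)]
  simp

/-- Anticommutation makes `F` exchange the two projectors, so the two branches of the reset trade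
places: one gains the flip `F` and the other loses it because `F² = 1`. -/
theorem resetChan_conj_flip {M F : Pauli V} (ρ : Op V)
    (h : pauliOp F * pauliOp M = -(pauliOp M * pauliOp F)) :
    resetChan M F (pauliOp F * ρ * pauliOp F) = resetChan M F ρ := by
  have hF := conjTranspose_pauliOp F
  have h1 := projPlus_mul_of_anticommute h
  have h2 := projMinus_mul_of_anticommute h
  unfold resetChan
  rw [sandwich_exchange h1 (exchange_adjoint hF hF (conjTranspose_projPlus M)
      (conjTranspose_projMinus M) h1),
    sandwich_exchange h2 (exchange_adjoint hF hF (conjTranspose_projMinus M)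
      (conjTranspose_projPlus M) h2), add_comm]
  congr 1
  calc _ = (pauliOp F * pauliOp F) * (projPlus M * ρ * projPlus M) *
        (pauliOp F * pauliOp F) := by simp only [mul_assoc]
    _ = _ := by rw [pauliOp_mul_self, one_mul, mul_one]

/-- The Pauli with its factor at `q` removed. -/
def erasePauli (q : V) (Q : Pauli V) : Pauli V :=
  (Function.update Q.1 q 0, Function.update Q.2 q 0)

theorem pauliX_commute {v : V} {Q : Pauli V} (h : Q.2 v = 0) :
    pauliOp (pauliX v) * pauliOp Q = pauliOp Q * pauliOp (pauliX v) := by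
  rw [pauliOp_mul_comm, commSign_pauliX, if_pos h]; simp

theorem pauliZ_commute {v : V} {Q : Pauli V} (h : Q.1 v = 0) :
    pauliOp (pauliZ v) * pauliOp Q = pauliOp Q * pauliOp (pauliZ v) := by
  rw [pauliOp_mul_comm, commSign_pauliZ, if_pos h]; simp

theorem pauliX_anticommute_pauliZ (v : V) :
    pauliOp (pauliX v) * pauliOp (pauliZ v) = -(pauliOp (pauliZ v) * pauliOp (pauliX v)) := by
  rw [pauliOp_mul_comm, commSign_pauliX, if_neg (by simp [pauliZ])]; simp

omit [Fintype V] in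
theorem eq_erasePauli_add (q : V) (Q : Pauli V) :
    Q = erasePauli q Q + ((if Q.1 q = 0 then 0 else pauliX q) +
      if Q.2 q = 0 then 0 else pauliZ q) := by
  have key : ∀ f : V → ZMod 2, ∀ v,
      f v = Function.update f q 0 v + (if f q = 0 then (0 : V → ZMod 2) else Pi.single q 1) v := by
    intro f v
    by_cases hv : v = q
    · subst hv
      obtain h | h := zmod_two_cases (f v) <;> simp [h]
    · split_ifs <;> simp [hv]
  refine Prod.ext (funext fun v => (key Q.1 v).trans ?_) (funext fun v => (key Q.2 v).trans ?_)
  · split_ifs <;> simp [erasePauli, pauliX, pauliZ]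
  · split_ifs <;> simp [erasePauli, pauliX, pauliZ]

/-- The factor of `Q` at `q` is a product of `X` and `Z`, one of which is `M` and the other the flip
`F`; both are absorbed. The rest of `Q` acts off `q` and commutes with `M` and `F`. -/
theorem resetChan_conj {M F : Pauli V} {q : V}
    (hMF : (M = pauliX q ∧ F = pauliZ q) ∨ (M = pauliZ q ∧ F = pauliX q)) (Q : Pauli V)
    (ρ : Op V) : resetChan M F (pauliOp Q * ρ * pauliOp Q) =
      pauliOp (erasePauli q Q) * resetChan M F ρ * pauliOp (erasePauli q Q) := by
  have hX : ∀ ρ, resetChan M F (pauliOp (pauliX q) * ρ * pauliOp (pauliX q)) =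
      resetChan M F ρ := by
    intro ρ
    rcases hMF with ⟨rfl, rfl⟩ | ⟨rfl, rfl⟩
    · exact resetChan_conj_self _ _ _
    · exact resetChan_conj_flip _ (pauliX_anticommute_pauliZ q)
  have hZ : ∀ ρ, resetChan M F (pauliOp (pauliZ q) * ρ * pauliOp (pauliZ q)) =
      resetChan M F ρ := by
    intro ρ
    rcases hMF with ⟨rfl, rfl⟩ | ⟨rfl, rfl⟩
    · refine resetChan_conj_flip _ ?_
      rw [pauliX_anticommute_pauliZ, neg_neg]
    · exact resetChan_conj_self _ _ _
  have hc1 : pauliOp (erasePauli q Q) * pauliOp (pauliX q) =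
      pauliOp (pauliX q) * pauliOp (erasePauli q Q) :=
    (pauliX_commute (by simp [erasePauli])).symm
  have hc2 : pauliOp (erasePauli q Q) * pauliOp (pauliZ q) =
      pauliOp (pauliZ q) * pauliOp (erasePauli q Q) :=
    (pauliZ_commute (by simp [erasePauli])).symm
  conv_lhs => rw [eq_erasePauli_add q Q, pauliOp_add_conj, pauliOp_add_conj]
  rw [resetChan_conj_of_commute]
  · congr 2
    have h1 : ∀ ρ, resetChan M F (pauliOp (if Q.1 q = 0 then 0 else pauliX q) * ρ *
        pauliOp (if Q.1 q = 0 then 0 else pauliX q)) = resetChan M F ρ := by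
      intro ρ; split_ifs
      · simp [pauliOp_zero]
      · exact hX ρ
    rw [h1]
    split_ifs
    · simp [pauliOp_zero]
    · exact hZ ρ
  · rcases hMF with ⟨rfl, rfl⟩ | ⟨rfl, rfl⟩ <;> assumption
  · rcases hMF with ⟨rfl, rfl⟩ | ⟨rfl, rfl⟩ <;> assumption

/-! ### CNOT gates -/

/-- The action of a CNOT on the computational basis. -/
def cnotMap (c t : V) (b : V → Fin 2) : V → Fin 2 := Function.update b t (b t + b c)

omit [Fintype V] in
theorem cnotMap_involutive {c t : V} (h : c ≠ t) : Function.Involutive (cnotMap c t) := by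
  intro b
  have key : ∀ x y : Fin 2, x + y + y = x := by decide
  simp [cnotMap, h, key]

theorem cnotOp_apply (c t : V) (a b : V → Fin 2) :
    cnotOp c t a b = if a = cnotMap c t b then 1 else 0 := rfl

theorem cnotOp_mul_apply {c t : V} (h : c ≠ t) (M : Op V) (a b : V → Fin 2) :
    (cnotOp c t * M) a b = M (cnotMap c t a) b := by
  rw [Matrix.mul_apply, Finset.sum_eq_single (cnotMap c t a)]
  · have : a = cnotMap c t (cnotMap c t a) := (cnotMap_involutive h a).symm
    rw [cnotOp_apply, if_pos this, one_mul]
  · intro x _ hx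
    have : ¬ a = cnotMap c t x := fun e => hx (by rw [e, cnotMap_involutive h])
    rw [cnotOp_apply, if_neg this, zero_mul]
  · simp

theorem mul_cnotOp_apply (c t : V) (M : Op V) (a b : V → Fin 2) :
    (M * cnotOp c t) a b = M a (cnotMap c t b) := by
  rw [Matrix.mul_apply, Finset.sum_eq_single (cnotMap c t b)]
  · rw [cnotOp_apply, if_pos rfl, mul_one]
  · intro x _ hx
    rw [cnotOp_apply, if_neg hx, mul_zero]
  · simp

/-- The sign is needed because Paulis are normalised to be Hermitian: a CNOT takes `X ⊗ Z` to `-Y ⊗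
Y`. It cancels in `cnotOp_conj`. -/
theorem cnot_two_qubits (xc zc xt zt : ZMod 2) : ∃ s : ℂ, s * s = 1 ∧
    ∀ ac bc ak bk : Fin 2,
      pauliMatrix xc zc ac bc * pauliMatrix xt zt (ak + ac) (bk + bc) =
        s * (pauliMatrix xc (zc + zt) ac bc * pauliMatrix (xt + xc) zt ak bk) := by
  obtain rfl | rfl := zmod_two_cases xc <;> obtain rfl | rfl := zmod_two_cases zc <;>
  obtain rfl | rfl := zmod_two_cases xt <;> obtain rfl | rfl := zmod_two_cases zt <;>
  first
  | (refine ⟨1, by simp, ?_⟩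
     simp [Fin.forall_fin_two, pauliMatrix, CharTwo.add_self_eq_zero]; done)
  | (refine ⟨-1, by simp, ?_⟩
     simp [Fin.forall_fin_two, pauliMatrix, CharTwo.add_self_eq_zero])

theorem cnotOp_mul_pauliOp {c t : V} (h : c ≠ t) (Q : Pauli V) : ∃ s : ℂ, s * s = 1 ∧
    cnotOp c t * pauliOp Q = s • (pauliOp ((Instr.cnot c t).push Q) * cnotOp c t) := by
  obtain ⟨s, hs, key⟩ := cnot_two_qubits (Q.1 c) (Q.2 c) (Q.1 t) (Q.2 t)
  refine ⟨s, hs, ?_⟩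
  -- A CNOT permutes the computational basis, so conjugating by it only relabels matrix entries. The
  -- labels change at `t` alone, with the bit at `c` as input, so all factors off `c` and `t` agree.
  have main : ∀ a b, pauliOp Q (cnotMap c t a) (cnotMap c t b) =
      s * pauliOp ((Instr.cnot c t).push Q) a b := by
    intro a b
    unfold pauliOp
    simp only [Matrix.of_apply]
    have hc : t ∈ (Finset.univ.erase c : Finset V) := by simp [h.symm]
    rw [← Finset.mul_prod_erase _ _ (Finset.mem_univ c), ← Finset.mul_prod_erase _ _ hc,
      ← Finset.mul_prod_erase (a := c) _ _ (Finset.mem_univ c),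
      ← Finset.mul_prod_erase (a := t) _ _ hc, ← mul_assoc, ← mul_assoc, ← mul_assoc]
    congr 1
    · simpa [cnotMap, Instr.push, h, h.symm, mul_assoc] using key (a c) (b c) (a t) (b t)
    · refine Finset.prod_congr rfl fun v hv => ?_
      simp only [Finset.mem_erase, Finset.mem_univ, and_true] at hv
      simp [cnotMap, Instr.push, hv.1, hv.2]
  ext a b
  rw [cnotOp_mul_apply h, Matrix.smul_apply, mul_cnotOp_apply, smul_eq_mul, ← main,
    cnotMap_involutive h]

theorem cnotOp_conj {c t : V} (h : c ≠ t) (Q : Pauli V) (ρ : Op V) :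
    cnotOp c t * (pauliOp Q * ρ * pauliOp Q) * (cnotOp c t)ᴴ =
      pauliOp ((Instr.cnot c t).push Q) * (cnotOp c t * ρ * (cnotOp c t)ᴴ) *
        pauliOp ((Instr.cnot c t).push Q) := by
  obtain ⟨s, hs, key⟩ := cnotOp_mul_pauliOp h Q
  have key' : pauliOp Q * (cnotOp c t)ᴴ =
      star s • ((cnotOp c t)ᴴ * pauliOp ((Instr.cnot c t).push Q)) := by
    simpa [Matrix.conjTranspose_mul, conjTranspose_pauliOp] using
      congrArg Matrix.conjTranspose key
  have hss : star s * s = 1 := by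
    rcases mul_self_eq_one_iff.1 hs with rfl | rfl <;> simp
  calc _ = (cnotOp c t * pauliOp Q) * ρ * (pauliOp Q * (cnotOp c t)ᴴ) := by
        simp only [mul_assoc]
    _ = (star s * s) • ((pauliOp ((Instr.cnot c t).push Q) * cnotOp c t) * ρ *
          ((cnotOp c t)ᴴ * pauliOp ((Instr.cnot c t).push Q))) := by
        rw [key, key']; simp [smul_smul]
    _ = _ := by rw [hss, one_smul]; simp only [mul_assoc]

/-! ### Circuits -/

/-- The CNOT gates of a circuit act on two distinct qubits. -/
def Instr.Proper {V : Type*} : Instr V → Prop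
  | .cnot c t => c ≠ t
  | _ => True

theorem Instr.chan_conj (g : Instr V) (hg : g.Proper) (Q : Pauli V) (ρ : Op V) :
    g.chan (pauliOp Q * ρ * pauliOp Q) =
      pauliOp (g.push Q) * g.chan ρ * pauliOp (g.push Q) := by
  cases g with
  | prepX q => exact resetChan_conj (Or.inl ⟨rfl, rfl⟩) Q ρ
  | prepZ q => exact resetChan_conj (Or.inr ⟨rfl, rfl⟩) Q ρ
  | cnot c t => exact cnotOp_conj hg Q ρ
  | measX q => exact measureChan_conj _ Q ρ
  | measZ q => exact measureChan_conj _ Q ρ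
  | idle q => rfl

theorem circuitChan_conj (c : List (Instr V)) (hc : ∀ g ∈ c, g.Proper) (Q : Pauli V) (ρ : Op V) :
    circuitChan c (pauliOp Q * ρ * pauliOp Q) =
      pauliOp (circuitPush c Q) * circuitChan c ρ * pauliOp (circuitPush c Q) := by
  induction c generalizing Q ρ with
  | nil => rfl
  | cons g c ih =>
    have := ih (fun g' hg' => hc g' (List.mem_cons_of_mem _ hg')) (g.push Q) (g.chan ρ)
    rw [← Instr.chan_conj g (hc g List.mem_cons_self)] at this
    exact this

/-- Instruction channels are linear. -/
theorem Instr.isLinearMap_chan (g : Instr V) : IsLinearMap ℂ g.chan := by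
  constructor
  · intro ρ ρ'
    cases g <;> simp only [Instr.chan, mul_add, add_mul] <;> abel
  · intro k ρ
    cases g <;> simp only [Instr.chan, mul_smul_comm, smul_mul_assoc, smul_add]

theorem isLinearMap_circuitChan (c : List (Instr V)) : IsLinearMap ℂ (circuitChan c) := by
  induction c with
  | nil => exact ⟨fun _ _ => rfl, fun _ _ => rfl⟩
  | cons g c ih =>
    refine ⟨fun ρ ρ' => ?_, fun k ρ => ?_⟩
    · change circuitChan c (g.chan (ρ + ρ')) = _
      rw [g.isLinearMap_chan.map_add, ih.map_add]; rfl
    · change circuitChan c (g.chan (k • ρ)) = _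
      rw [g.isLinearMap_chan.map_smul, ih.map_smul]; rfl

end Propagation

/-! ### Partial trace -/

section PartialTrace

variable {W D : Type*} [Fintype W] [DecidableEq W] [Fintype D] [DecidableEq D]

omit [Fintype D] [DecidableEq D] in
theorem isLinearMap_partialTrace :
    IsLinearMap ℂ (partialTrace : Op (W ⊕ D) → Op D) := by
  constructor
  · intro ρ ρ'; ext a b; simp [partialTrace, Finset.sum_add_distrib]
  · intro k ρ; ext a b; simp [partialTrace, Finset.mul_sum]

/-- The factor of a Pauli on the qubits of `W`. -/
def ancillaPart (Q : Pauli (W ⊕ D)) : Pauli W :=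
  (fun w => Q.1 (Sum.inl w), fun w => Q.2 (Sum.inl w))

/-- The block of an operator between two basis states of `W`. -/
def dataBlock (ρ : Op (W ⊕ D)) (c c' : W → Fin 2) : Op D :=
  Matrix.of fun a b => ρ (Sum.elim c a) (Sum.elim c' b)

omit [Fintype D] [DecidableEq D] in
theorem partialTrace_eq_sum (ρ : Op (W ⊕ D)) : partialTrace ρ = ∑ c, dataBlock ρ c c := by
  ext a b
  simp [partialTrace, dataBlock, Matrix.sum_apply]

theorem dataBlock_mul (M N : Op (W ⊕ D)) (c c' : W → Fin 2) :
    dataBlock (M * N) c c' = ∑ k, dataBlock M c k * dataBlock N k c' := by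
  ext a b
  simp only [dataBlock, Matrix.of_apply, Matrix.sum_apply, Matrix.mul_apply]
  rw [← (Equiv.sumArrowEquivProdArrow W D (Fin 2)).symm.sum_comp, Fintype.sum_prod_type]
  rfl

omit [DecidableEq W] [DecidableEq D] in
theorem dataBlock_pauliOp (Q : Pauli (W ⊕ D)) (c c' : W → Fin 2) :
    dataBlock (pauliOp Q) c c' = pauliOp (ancillaPart Q) c c' • pauliOp (dataPart Q) := by
  ext a b
  simp [dataBlock, pauliOp, Fintype.prod_sum_type, ancillaPart, dataPart]

/-- The partial trace is cyclic for the ancilla factor of `Q`, which squares to the identity; only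
the data factor survives. -/
theorem partialTrace_conj (Q : Pauli (W ⊕ D)) (ρ : Op (W ⊕ D)) :
    partialTrace (pauliOp Q * ρ * pauliOp Q) =
      pauliOp (dataPart Q) * partialTrace ρ * pauliOp (dataPart Q) := by
  have horth : ∀ k l : W → Fin 2, ∑ c, pauliOp (ancillaPart Q) l c *
      pauliOp (ancillaPart Q) c k = if l = k then 1 else 0 := by
    intro k l
    rw [← Matrix.mul_apply, pauliOp_mul_self, Matrix.one_apply]
  simp only [partialTrace_eq_sum, dataBlock_mul, dataBlock_pauliOp, Finset.sum_mul,
    Finset.mul_sum, smul_mul_assoc, mul_smul_comm, Finset.smul_sum, smul_smul]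
  rw [Finset.sum_comm]
  refine Finset.sum_congr rfl fun l _ => ?_
  rw [Finset.sum_comm]
  simp only [← Finset.sum_smul, horth, ite_smul, one_smul, zero_smul]
  simp

end PartialTrace

/-! ### Products of two-term sums indexed by subsets -/

section SubsetWeight

variable {ι R : Type*} [DecidableEq ι] [CommRing R]

/-- The term of `B` in the expansion of `∏ a ∈ A, (p a + q a)`. -/
def subsetWeight (p q : ι → R) (A B : Finset ι) : R := (∏ a ∈ B, p a) * ∏ a ∈ A \ B, q a

theorem subsetWeight_insert_left {p q : ι → R} {A B : Finset ι} {a : ι} (ha : a ∉ A)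
    (hB : B ⊆ A) : subsetWeight p q (insert a A) B = q a * subsetWeight p q A B := by
  have haB : a ∉ B := fun h => ha (hB h)
  rw [subsetWeight, Finset.insert_sdiff_of_notMem _ haB, Finset.prod_insert (by simp [ha]),
    subsetWeight]
  ring

theorem subsetWeight_insert_insert {p q : ι → R} {A B : Finset ι} {a : ι} (ha : a ∉ A)
    (hB : B ⊆ A) : subsetWeight p q (insert a A) (insert a B) = p a * subsetWeight p q A B := by
  have haB : a ∉ B := fun h => ha (hB h)
  rw [subsetWeight, Finset.insert_sdiff_insert, Finset.sdiff_insert_of_notMem ha,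
    Finset.prod_insert haB, subsetWeight]
  ring

end SubsetWeight

/-! ### Sums of independent Bernoulli variables -/

section Bernoulli

variable {ι : Type*} [DecidableEq ι]

/-- `Pr[N ≥ k]` for a sum `N` of independent Bernoulli variables with parameters `p a`, `a ∈ A`. -/
noncomputable def bernoulliTail (p : ι → ℝ) (k : ℕ) (A : Finset ι) : ℝ :=
  ∑ B ∈ A.powerset.filter (fun B => k ≤ B.card), subsetWeight p (fun a => 1 - p a) A B

theorem bernoulliTail_zero (p : ι → ℝ) (A : Finset ι) : bernoulliTail p 0 A = 1 := by
  have h := Finset.prod_add p (fun a => 1 - p a) A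
  simp only [add_sub_cancel, Finset.prod_const_one] at h
  simp only [bernoulliTail, zero_le, Finset.filter_true, subsetWeight]
  exact h.symm

/-- Condition on the variable at `a`: either it is 0 and the others must reach `k + 1`, or it is 1
and they need only reach `k`. -/
theorem bernoulliTail_insert (p : ι → ℝ) (k : ℕ) {A : Finset ι} {a : ι} (ha : a ∉ A) :
    bernoulliTail p (k + 1) (insert a A) =
      (1 - p a) * bernoulliTail p (k + 1) A + p a * bernoulliTail p k A := by
  simp only [bernoulliTail, Finset.sum_filter, Finset.sum_powerset_insert ha, Finset.mul_sum]
  congr 1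
  · refine Finset.sum_congr rfl fun B hB => ?_
    rw [subsetWeight_insert_left ha (Finset.mem_powerset.1 hB)]
    simp
  · refine Finset.sum_congr rfl fun B hB => ?_
    have haB : a ∉ B := fun h => ha (Finset.mem_powerset.1 hB h)
    rw [subsetWeight_insert_insert ha (Finset.mem_powerset.1 hB), Finset.card_insert_of_notMem haB]
    simp

theorem bernoulliTail_nonneg {p : ι → ℝ} (h0 : ∀ a, 0 ≤ p a) (h1 : ∀ a, p a ≤ 1) (k : ℕ)
    (A : Finset ι) : 0 ≤ bernoulliTail p k A :=
  Finset.sum_nonneg fun _ _ => mul_nonneg (Finset.prod_nonneg fun a _ => h0 a)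
    (Finset.prod_nonneg fun a _ => sub_nonneg.2 (h1 a))

theorem bernoulliTail_one_le {p : ι → ℝ} (h0 : ∀ a, 0 ≤ p a) (h1 : ∀ a, p a ≤ 1)
    (A : Finset ι) : bernoulliTail p 1 A ≤ ∑ a ∈ A, p a := by
  induction A using Finset.induction_on with
  | empty => simp [bernoulliTail, Finset.sum_filter]
  | insert a A ha ih =>
    rw [bernoulliTail_insert p 0 ha, bernoulliTail_zero, Finset.sum_insert ha]
    nlinarith [mul_nonneg (h0 a) (bernoulliTail_nonneg h0 h1 1 A)]

theorem bernoulliTail_two_le {p : ι → ℝ} (h0 : ∀ a, 0 ≤ p a) (h1 : ∀ a, p a ≤ 1)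
    (A : Finset ι) : bernoulliTail p 2 A ≤ (∑ a ∈ A, p a) ^ 2 / 2 := by
  induction A using Finset.induction_on with
  | empty => simp [bernoulliTail, Finset.sum_filter]
  | insert a A ha ih =>
    rw [bernoulliTail_insert p 1 ha, Finset.sum_insert ha]
    -- With `s` the sum over `A`, the new tail is at most `s²/2 + p a * s`, which is `(p a + s)²/2`
    -- short of `(p a)²/2`.
    nlinarith [mul_nonneg (h0 a) (bernoulliTail_nonneg h0 h1 2 A),
      mul_le_mul_of_nonneg_left (bernoulliTail_one_le h0 h1 A) (h0 a), sq_nonneg (p a)]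

end Bernoulli

/-! ### Exponentials of commuting Paulis -/

section Exponential

variable {V : Type*} [Fintype V] [DecidableEq V]

/-- The exponential of a multiple of an involution. -/
theorem exp_smul_involution {S : Op V} (hS : S * S = 1) (z : ℂ) :
    NormedSpace.exp (z • S) = Complex.cosh z • (1 : Op V) + Complex.sinh z • S := by
  -- `f` assigns to a pair of eigenvalues the operator having them on the `+1` and `-1` eigenspaces
  -- of `S`. As a continuous ring homomorphism it commutes with `exp`, and `z • S` is the image of
  -- `(z, -z)`.
  let f : ℂ × ℂ →+* Op V :=
    { toFun := fun w => ((w.1 + w.2) / 2) • (1 : Op V) + ((w.1 - w.2) / 2) • S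
      map_one' := by simp
      map_zero' := by simp
      map_add' := fun w w' => by
        simp only [Prod.fst_add, Prod.snd_add]; module
      map_mul' := fun w w' => by
        simp only [Prod.fst_mul, Prod.snd_mul, mul_add, add_mul, smul_mul_assoc, mul_smul_comm,
          one_mul, mul_one, hS]
        module }
  have hf : Continuous f := by
    change Continuous fun w : ℂ × ℂ =>
      ((w.1 + w.2) / 2) • (1 : Op V) + ((w.1 - w.2) / 2) • S
    fun_prop
  let _ : NormedRing (Op V) := Matrix.linftyOpNormedRing
  let _ : NormedAlgebra ℂ (Op V) := Matrix.linftyOpNormedAlgebra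
  have h := NormedSpace.map_exp f hf (z, -z)
  have hz : f (z, -z) = z • S := by
    change ((z + -z) / 2) • (1 : Op V) + ((z - -z) / 2) • S = z • S
    module
  rw [hz] at h
  refine h.symm.trans ?_
  change (((NormedSpace.exp (z, -z) : ℂ × ℂ).1 + (NormedSpace.exp (z, -z) : ℂ × ℂ).2) / 2) •
    (1 : Op V) + (((NormedSpace.exp (z, -z) : ℂ × ℂ).1 -
      (NormedSpace.exp (z, -z) : ℂ × ℂ).2) / 2) • S = _
  rw [Prod.fst_exp, Prod.snd_exp, Complex.cosh, Complex.sinh, Complex.exp_eq_exp_ℂ]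

theorem commute_of_mem_splitPaulis {s : Set V} {Q R : Pauli V} (hQ : Q ∈ splitPaulis s)
    (hR : R ∈ splitPaulis s) : Commute (pauliOp Q) (pauliOp R) := by
  rw [Commute, SemiconjBy, pauliOp_mul_of_mem_splitPaulis hQ hR,
    pauliOp_mul_of_mem_splitPaulis hR hQ, add_comm]

/-- The amplitude of the set `B` in `∏ a ∈ A, (cos (θ a) - i sin (θ a) S a)`. -/
noncomputable def amplitude {ι : Type*} [DecidableEq ι] (θ : ι → ℝ) (A B : Finset ι) : ℂ :=
  subsetWeight (fun a => -Complex.I * Complex.sin (θ a)) (fun a => Complex.cos (θ a)) A B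

/-- The commuting exponentials factor, and expanding the product chooses a set `B` of events.
Membership in `splitPaulis` gives both the commutation and the absence of phases in the product over
`B`. -/
theorem exp_sum_pauliOp {ι : Type*} [DecidableEq ι] {s : Set V} (S : ι → Pauli V)
    (hS : ∀ a, S a ∈ splitPaulis s) (θ : ι → ℝ) (A : Finset ι) :
    NormedSpace.exp (∑ a ∈ A, (-Complex.I * (θ a : ℂ)) • pauliOp (S a)) =
      ∑ B ∈ A.powerset, amplitude θ A B • pauliOp (∑ a ∈ B, S a) := by
  induction A using Finset.induction_on with
  | empty => simp [amplitude, subsetWeight, pauliOp_zero]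
  | insert a A ha ih =>
    rw [Finset.sum_insert ha, Matrix.exp_add_of_commute, ih,
      exp_smul_involution (pauliOp_mul_self _), Finset.sum_powerset_insert ha, add_mul,
      Finset.mul_sum, Finset.mul_sum]
    · have hcosh : Complex.cosh (-Complex.I * θ a) = Complex.cos (θ a) := by
        rw [neg_mul, Complex.cosh_neg, mul_comm, Complex.cosh_mul_I]
      have hsinh : Complex.sinh (-Complex.I * θ a) = -Complex.I * Complex.sin (θ a) := by
        rw [neg_mul, Complex.sinh_neg, mul_comm, Complex.sinh_mul_I]; ring
      rw [hcosh, hsinh]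
      congr 1
      · refine Finset.sum_congr rfl fun B hB => ?_
        unfold amplitude
        rw [subsetWeight_insert_left ha (Finset.mem_powerset.1 hB), smul_mul_smul_comm, one_mul]
      · refine Finset.sum_congr rfl fun B hB => ?_
        have haB : a ∉ B := fun h => ha (Finset.mem_powerset.1 hB h)
        unfold amplitude
        rw [subsetWeight_insert_insert ha (Finset.mem_powerset.1 hB), smul_mul_smul_comm,
          pauliOp_mul_of_mem_splitPaulis (hS a) (AddSubgroup.sum_mem _ fun b _ => hS b),
          Finset.sum_insert haB]
    · refine Commute.sum_right _ _ _ fun b _ => ?_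
      exact ((commute_of_mem_splitPaulis (hS a) (hS b)).smul_left _).smul_right _

/-- This links quantum amplitudes to the Bernoulli model: `cos² = 1 - sin²` turns the squared
modulus into the probability that exactly the events of `B` occur. -/
theorem norm_sq_amplitude {ι : Type*} [DecidableEq ι] (θ : ι → ℝ) (A B : Finset ι) :
    ‖amplitude θ A B‖ ^ 2 =
      subsetWeight (fun a => Real.sin (θ a) ^ 2) (fun a => 1 - Real.sin (θ a) ^ 2) A B := by
  simp only [amplitude, subsetWeight, norm_mul, norm_prod, norm_neg, Complex.norm_I, one_mul,
    mul_pow, ← Finset.prod_pow, ← Complex.ofReal_sin, ← Complex.ofReal_cos, Complex.norm_real,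
    Real.norm_eq_abs, sq_abs, Real.cos_sq']

end Exponential

/-! ### The Pauli twirl of a unitary channel -/

section Twirl

variable {V : Type*} [Fintype V] [DecidableEq V]

theorem twirlProb_sum (u : Pauli V → ℂ) (Q : Pauli V) :
    twirlProb (∑ R, u R • pauliOp R) Q = ‖u Q‖ ^ 2 := by
  have h : Matrix.trace (pauliOp Q * ∑ R, u R • pauliOp R) = u Q * 2 ^ Fintype.card V := by
    simp [Finset.mul_sum, Matrix.trace_sum, trace_pauliOp_mul]
  have h4 : ((2 : ℝ) ^ Fintype.card V) ^ 2 = 4 ^ Fintype.card V := by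
    rw [← pow_mul, mul_comm, pow_mul]; norm_num
  rw [twirlProb, h, norm_mul, norm_pow, Complex.norm_ofNat, mul_pow, h4]
  exact mul_div_cancel_right₀ _ (by positivity)

/-- Conjugation by `R` multiplies the cross term of `Q` and `Q'` by `commSign R Q * commSign R Q'`.
Averaging over `R` kills it unless `Q = Q'`, by orthogonality of characters. -/
theorem pauliTwirl_sum (u : Pauli V → ℂ) (ρ : Op V) :
    pauliTwirl (fun ρ => (∑ R, u R • pauliOp R) * ρ * (∑ R, u R • pauliOp R)ᴴ) ρ =
      ∑ Q, ((‖u Q‖ ^ 2 : ℝ) : ℂ) • (pauliOp Q * ρ * pauliOp Q) := by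
  have hterm : ∀ R : Pauli V,
      pauliOp R * ((∑ Q, u Q • pauliOp Q) * (pauliOp R * ρ * pauliOp R) *
        (∑ Q, u Q • pauliOp Q)ᴴ) * pauliOp R =
      ∑ Q, ∑ Q', ((commSign R Q * commSign R Q' : ℤ) : ℂ) •
        ((u Q * star (u Q')) • (pauliOp Q * ρ * pauliOp Q')) := by
    intro R
    have h1 : pauliOp R * (∑ Q, u Q • pauliOp Q) * pauliOp R =
        ∑ Q, (u Q * commSign R Q) • pauliOp Q := by
      simp [Finset.mul_sum, Finset.sum_mul, pauliOp_conj_pauliOp, smul_smul]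
    have h2 : pauliOp R * (∑ Q, u Q • pauliOp Q)ᴴ * pauliOp R =
        ∑ Q, (star (u Q) * commSign R Q) • pauliOp Q := by
      simp [Matrix.conjTranspose_sum, Matrix.conjTranspose_smul, conjTranspose_pauliOp,
        Finset.mul_sum, Finset.sum_mul, pauliOp_conj_pauliOp, smul_smul]
    calc _ = (pauliOp R * (∑ Q, u Q • pauliOp Q) * pauliOp R) * ρ *
          (pauliOp R * (∑ Q, u Q • pauliOp Q)ᴴ * pauliOp R) := by simp only [mul_assoc]
      _ = _ := by
        rw [h1, h2]
        simp only [Finset.sum_mul, Finset.mul_sum, smul_mul_assoc, mul_smul_comm, smul_smul,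
          Finset.smul_sum]
        rw [Finset.sum_comm]
        refine Finset.sum_congr rfl fun Q _ => Finset.sum_congr rfl fun Q' _ => ?_
        congr 1
        push_cast; ring
  unfold pauliTwirl
  simp only [hterm]
  rw [Finset.sum_comm, Finset.smul_sum]
  refine Finset.sum_congr rfl fun Q _ => ?_
  rw [Finset.sum_comm]
  simp only [← Finset.sum_smul, ← Int.cast_sum, sum_commSign_mul]
  rw [Finset.sum_eq_single Q]
  · rw [if_pos rfl, smul_smul, smul_smul]
    congr 1
    push_cast
    rw [inv_mul_cancel₀ (pow_ne_zero _ (by norm_num)), one_mul]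
    exact Complex.mul_conj' _
  · intro Q' _ hne
    rw [if_neg hne.symm]; simp
  · simp

variable {ι : Type*} [DecidableEq ι]

/-- The amplitude of a Pauli: the sum over the sets of events whose product is this Pauli. -/
noncomputable def pauliAmplitude (S : ι → Pauli V) (θ : ι → ℝ) (A : Finset ι) (Q : Pauli V) : ℂ :=
  ∑ B ∈ A.powerset.filter (fun B => ∑ a ∈ B, S a = Q), amplitude θ A B

theorem exp_sum_eq_sum_pauliAmplitude {s : Set V} (S : ι → Pauli V)
    (hS : ∀ a, S a ∈ splitPaulis s) (θ : ι → ℝ) (A : Finset ι) :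
    NormedSpace.exp (∑ a ∈ A, (-Complex.I * (θ a : ℂ)) • pauliOp (S a)) =
      ∑ Q, pauliAmplitude S θ A Q • pauliOp Q := by
  rw [exp_sum_pauliOp S hS]
  simp only [pauliAmplitude, Finset.sum_smul]
  rw [← Finset.sum_fiberwise A.powerset (fun B => ∑ a ∈ B, S a)]
  refine Finset.sum_congr rfl fun Q _ => Finset.sum_congr rfl fun B hB => ?_
  rw [(Finset.mem_filter.1 hB).2]

/-- The probability of a class of Paulis that arise only from two or more events, bounded by
Cauchy–Schwarz. -/
theorem sum_norm_sq_pauliAmplitude_le (S : ι → Pauli V) (θ : ι → ℝ) (A : Finset ι)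
    (bad : Pauli V → Prop) [DecidablePred bad] (n : ℕ)
    (hbad : ∀ B ⊆ A, bad (∑ a ∈ B, S a) → 2 ≤ B.card)
    (hn : ∀ Q, (A.powerset.filter fun B => ∑ a ∈ B, S a = Q ∧ 2 ≤ B.card).card ≤ n) :
    (∑ Q, if bad Q then ‖pauliAmplitude S θ A Q‖ ^ 2 else 0) ≤
      n * bernoulliTail (fun a => Real.sin (θ a) ^ 2) 2 A := by
  set w : Finset ι → ℝ :=
    subsetWeight (fun a => Real.sin (θ a) ^ 2) (fun a => 1 - Real.sin (θ a) ^ 2) A with hw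
  have hw0 : ∀ B, 0 ≤ w B := fun B => by rw [hw, ← norm_sq_amplitude]; positivity
  have hQ : ∀ Q, (if bad Q then ‖pauliAmplitude S θ A Q‖ ^ 2 else 0) ≤
      n * ∑ B ∈ A.powerset.filter (fun B => ∑ a ∈ B, S a = Q ∧ 2 ≤ B.card), w B := by
    intro Q
    split_ifs with h
    -- Only sets with two or more events contribute to a bad `Q`, so its amplitude has at most `n`
    -- terms and Cauchy–Schwarz costs a factor `n`.
    · have hset : A.powerset.filter (fun B => ∑ a ∈ B, S a = Q) =
          A.powerset.filter (fun B => ∑ a ∈ B, S a = Q ∧ 2 ≤ B.card) := by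
        refine Finset.filter_congr fun B hB => ⟨fun e => ⟨e, ?_⟩, fun e => e.1⟩
        exact hbad B (Finset.mem_powerset.1 hB) (e ▸ h)
      rw [pauliAmplitude, hset]
      calc _ ≤ (∑ B ∈ A.powerset.filter (fun B => ∑ a ∈ B, S a = Q ∧ 2 ≤ B.card),
            ‖amplitude θ A B‖) ^ 2 := by gcongr; exact norm_sum_le _ _
        _ ≤ _ := sq_sum_le_card_mul_sum_sq
        _ ≤ _ := by
          simp only [norm_sq_amplitude]
          gcongr
          · exact Finset.sum_nonneg fun B _ => hw0 B
          · exact hn Q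
    · exact mul_nonneg (Nat.cast_nonneg _) (Finset.sum_nonneg fun B _ => hw0 B)
  refine (Finset.sum_le_sum fun Q _ => hQ Q).trans ?_
  rw [← Finset.mul_sum, bernoulliTail]
  refine le_of_eq ?_
  congr 1
  -- Each set with at least two events has exactly one product, so the fibres over all `Q`
  -- reassemble the tail without overcounting.
  rw [← Finset.sum_fiberwise (A.powerset.filter fun B => 2 ≤ B.card) (fun B => ∑ a ∈ B, S a)]
  refine Finset.sum_congr rfl fun Q _ => Finset.sum_congr ?_ fun _ _ => rfl
  rw [Finset.filter_filter]
  exact Finset.filter_congr fun B _ => and_comm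

end Twirl

variable {ℓ m : ℕ}

/-! ### Instructions of the schedule -/

/-- The instructions that occur in the cycle: CNOTs from the `X` ancillas to data qubits and from
data qubits to the `Z` ancillas, resets of ancillas, measurements, and idling. -/
def Instr.IsExtraction : Instr (Qubit ℓ m) → Prop
  | .prepX q => ∃ w, q = Sum.inl w
  | .prepZ q => ∃ w, q = Sum.inl w
  | .cnot c t => (∃ i d, c = qX i ∧ t = Sum.inr d) ∨ ∃ i d, c = Sum.inr d ∧ t = qZ i
  | _ => True

theorem Instr.IsExtraction.proper {g : Instr (Qubit ℓ m)} (h : g.IsExtraction) : g.Proper := by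
  cases g with
  | cnot c t =>
    rcases h with ⟨i, d, rfl, rfl⟩ | ⟨i, d, rfl, rfl⟩ <;> simp [Instr.Proper, qX, qZ]
  | _ => trivial

section Schedule

variable [NeZero ℓ] [NeZero m]

theorem mem_forAll {f : Cell ℓ m → List (Instr (Qubit ℓ m))} {g : Instr (Qubit ℓ m)} :
    g ∈ forAll f ↔ ∃ i, g ∈ f i := by
  simp [forAll]

theorem BBCode.isExtraction_of_mem_round (C : BBCode ℓ m) (n : ℕ) {g : Instr (Qubit ℓ m)}
    (hg : g ∈ C.round n) : g.IsExtraction := by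
  unfold BBCode.round at hg
  split at hg <;> try simp only [List.not_mem_nil] at hg
  all_goals
    obtain ⟨i, hi⟩ := mem_forAll.1 hg
    simp only [List.mem_cons, List.not_mem_nil, or_false] at hi
    rcases hi with rfl | rfl | rfl | rfl <;> simp [Instr.IsExtraction, qX, qZ, qL, qR]

theorem BBCode.isExtraction_of_mem_remaining (C : BBCode ℓ m) (pre : Bool) (t : ℕ)
    {g : Instr (Qubit ℓ m)} (hg : g ∈ C.remaining pre t) : g.IsExtraction := by
  rcases List.mem_append.1 hg with h | h
  · cases pre
    · simp at h
    · exact C.isExtraction_of_mem_round t h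
  · obtain ⟨n, -, hn⟩ := List.mem_flatMap.1 h
    exact C.isExtraction_of_mem_round n hn

theorem BBCode.toData_conj (C : BBCode ℓ m) (pre : Bool) (t : ℕ) (Q : Pauli (Qubit ℓ m))
    (ρ : Op (Qubit ℓ m)) :
    C.toData pre t (pauliOp Q * ρ * pauliOp Q) =
      pauliOp (C.propagate pre t Q) * C.toData pre t ρ * pauliOp (C.propagate pre t Q) := by
  unfold BBCode.toData BBCode.propagate
  rw [circuitChan_conj _ fun g hg => (C.isExtraction_of_mem_remaining pre t hg).proper]
  exact partialTrace_conj _ _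

theorem BBCode.isLinearMap_toData (C : BBCode ℓ m) (pre : Bool) (t : ℕ) :
    IsLinearMap ℂ (C.toData pre t) := by
  have h1 := isLinearMap_circuitChan (C.remaining pre t)
  have h2 := isLinearMap_partialTrace (W := AncQubit ℓ m) (D := DataQubit ℓ m)
  exact ⟨fun ρ ρ' => by simp only [BBCode.toData, h1.map_add, h2.map_add],
    fun k ρ => by simp only [BBCode.toData, h1.map_smul, h2.map_smul]⟩

end Schedule

/-! ### Paulis that do not spread over the data -/

/-- No `X` component on the `X` ancillas and no `Z` component on the `Z` ancillas: such a Pauli is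
never copied to a data qubit. -/
def IsNonspreading (Q : Pauli (Qubit ℓ m)) : Prop :=
  (∀ i, Q.1 (qX i) = 0) ∧ ∀ i, Q.2 (qZ i) = 0

/-- A CNOT copies `X` from control to target and `Z` from target to control. Data could only receive
an `X` from an `X` ancilla or a `Z` from a `Z` ancilla, and both are absent. The copies that do
occur, `Z` onto an `X` ancilla and `X` onto a `Z` ancilla, respect the invariant; resets touch
ancillas only. -/
theorem Instr.push_of_isNonspreading {g : Instr (Qubit ℓ m)} (hg : g.IsExtraction)
    {Q : Pauli (Qubit ℓ m)} (hQ : IsNonspreading Q) :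
    IsNonspreading (g.push Q) ∧ dataPart (g.push Q) = dataPart Q := by
  have hupd : ∀ (f : Qubit ℓ m → ZMod 2) (q q' : Qubit ℓ m), f q = 0 →
      Function.update f q' 0 q = 0 := by
    intro f q q' h
    by_cases hq : q = q'
    · subst hq; simp
    · simp [hq, h]
  cases g with
  | prepX q =>
    obtain ⟨w, rfl⟩ := hg
    exact ⟨⟨fun i => hupd _ _ _ (hQ.1 i), fun i => hupd _ _ _ (hQ.2 i)⟩, by
      simp [dataPart, Instr.push]⟩
  | prepZ q =>
    obtain ⟨w, rfl⟩ := hg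
    exact ⟨⟨fun i => hupd _ _ _ (hQ.1 i), fun i => hupd _ _ _ (hQ.2 i)⟩, by
      simp [dataPart, Instr.push]⟩
  | cnot c t =>
    obtain ⟨hx, hz⟩ := hQ
    rcases hg with ⟨i, d, rfl, rfl⟩ | ⟨i, d, rfl, rfl⟩
    · have h : (Instr.cnot (qX i) (Sum.inr d)).push Q =
          (Q.1, Function.update Q.2 (qX i) (Q.2 (qX i) + Q.2 (Sum.inr d))) := by
        simp [Instr.push, hx]
      rw [h]
      refine ⟨⟨hx, fun j => ?_⟩, ?_⟩
      · have : qZ j ≠ (qX i : Qubit ℓ m) := by simp [qX, qZ]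
        simp [this, hz]
      · simp [dataPart, qX]
    · have h : (Instr.cnot (Sum.inr d) (qZ i)).push Q =
          (Function.update Q.1 (qZ i) (Q.1 (qZ i) + Q.1 (Sum.inr d)), Q.2) := by
        simp [Instr.push, hz]
      rw [h]
      refine ⟨⟨fun j => ?_, hz⟩, ?_⟩
      · have : qX j ≠ (qZ i : Qubit ℓ m) := by simp [qX, qZ]
        simp [this, hx]
      · simp [dataPart, qZ]
  | measX q => exact ⟨hQ, rfl⟩
  | measZ q => exact ⟨hQ, rfl⟩
  | idle q => exact ⟨hQ, rfl⟩

theorem dataPart_circuitPush {c : List (Instr (Qubit ℓ m))} (hc : ∀ g ∈ c, g.IsExtraction)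
    {Q : Pauli (Qubit ℓ m)} (hQ : IsNonspreading Q) :
    dataPart (circuitPush c Q) = dataPart Q := by
  induction c generalizing Q with
  | nil => rfl
  | cons g c ih =>
    obtain ⟨h1, h2⟩ := Instr.push_of_isNonspreading (hc g List.mem_cons_self) hQ
    exact (ih (fun g' hg' => hc g' (List.mem_cons_of_mem _ hg')) h1).trans h2

/-- The qubits of the register `q(L)`. -/
def registerL (ℓ m : ℕ) : Set (Qubit ℓ m) := Set.range qL

theorem blockPauli_apply_qZ (e : Block ℓ m) (i : Cell ℓ m) : (blockPauli e).2 (qZ i) = 0 := by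
  unfold blockPauli
  split <;> simp [pauliX, pauliZ, qX, qZ, qR]

theorem blockPauli_mem_splitPaulis (e : Block ℓ m) :
    blockPauli e ∈ splitPaulis (registerL ℓ m) := by
  unfold blockPauli
  split
  · rename_i i j
    refine ⟨fun v _ => rfl, fun v hv => ?_⟩
    have : v ≠ qL i := fun h => hv ⟨i, h.symm⟩
    simp [pauliX, this]
  · refine ⟨?_, fun v _ => by simp [pauliZ]⟩
    rintro _ ⟨j, rfl⟩
    simp [pauliZ, qX, qR, qL]
  · exact AddSubgroup.zero_mem _

theorem pairPauli_mem_splitPaulis (a : Sym2 (Block ℓ m)) :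
    pairPauli a ∈ splitPaulis (registerL ℓ m) := by
  induction a using Sym2.ind with
  | _ e e' =>
    exact AddSubgroup.add_mem _ (blockPauli_mem_splitPaulis e) (blockPauli_mem_splitPaulis e')

theorem isNonspreading_pairPauli (a : Sym2 (Block ℓ m)) : IsNonspreading (pairPauli a) := by
  refine ⟨fun i => (pairPauli_mem_splitPaulis a).2 _ ?_, fun i => ?_⟩
  · rintro ⟨j, hj⟩; simp [qL, qX] at hj
  · induction a using Sym2.ind with
    | _ e e' =>
      change (blockPauli e).2 (qZ i) + (blockPauli e').2 (qZ i) = 0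
      rw [blockPauli_apply_qZ, blockPauli_apply_qZ, add_zero]

/-! ### Blocks of the `B` rounds -/

theorem dataPart_blockPauli_L (i j : Cell ℓ m) :
    dataPart (blockPauli (qL i, qZ j)) = Sector.X.pauliAt (DataReg.L, i) := by
  refine Prod.ext (funext fun d => ?_) (funext fun d => ?_) <;>
    simp [dataPart, blockPauli, qL, qZ, pauliX, Sector.pauliAt, Pi.single_apply]

theorem dataPart_blockPauli_R (i j : Cell ℓ m) :
    dataPart (blockPauli (qX i, qR j)) = Sector.Z.pauliAt (DataReg.R, j) := by
  refine Prod.ext (funext fun d => ?_) (funext fun d => ?_) <;>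
    simp [dataPart, blockPauli, qX, qR, pauliZ, Sector.pauliAt, Pi.single_apply]

theorem dataPart_pairPauli (e e' : Block ℓ m) :
    dataPart (pairPauli s(e, e')) = dataPart (blockPauli e) + dataPart (blockPauli e') := rfl

section Rounds

variable [NeZero ℓ] [NeZero m]

theorem BBCode.propagate_pairPauli (C : BBCode ℓ m) (pre : Bool) (t : ℕ)
    (a : Sym2 (Block ℓ m)) : C.propagate pre t (pairPauli a) = dataPart (pairPauli a) :=
  dataPart_circuitPush (fun _ hg => C.isExtraction_of_mem_remaining pre t hg)
    (isNonspreading_pairPauli a)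

theorem BBCode.propagate_zero (C : BBCode ℓ m) (pre : Bool) (t : ℕ) :
    C.propagate pre t 0 = 0 :=
  dataPart_circuitPush (fun _ hg => C.isExtraction_of_mem_remaining pre t hg)
    ⟨fun _ => rfl, fun _ => rfl⟩

/-- In a `B` round, every block is `q(L, i - b') → q(Z, i)` or `q(X, i) → q(R, i + b)`. -/
theorem BBCode.exists_of_mem_activeBlocks (C : BBCode ℓ m) {t : ℕ} (ht : t ∈ bRounds) :
    ∃ b b' : Cell ℓ m, ∀ e ∈ C.activeBlocks t,
      ∃ i, e = (qL (i - b'), qZ i) ∨ e = (qX i, qR (i + b)) := by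
  -- The three `B` rounds have the same form and differ only in their two monomials.
  have key : ∀ b b' : Cell ℓ m,
      C.round t = forAll (fun i => [.cnot (qX i) (qR (i + b)), .cnot (qL (i - b')) (qZ i)]) →
      ∀ e ∈ C.activeBlocks t, ∃ i, e = (qL (i - b'), qZ i) ∨ e = (qX i, qR (i + b)) := by
    intro b b' hround e he
    simp only [BBCode.activeBlocks, Finset.mem_filter, hround] at he
    obtain ⟨i, hi⟩ := mem_forAll.1 he.2
    simp only [List.mem_cons, Instr.cnot.injEq, List.not_mem_nil, or_false] at hi
    exact ⟨i, by rw [Prod.ext_iff, Prod.ext_iff]; exact hi.symm⟩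
  simp only [bRounds, Finset.mem_insert, Finset.mem_singleton] at ht
  rcases ht with rfl | rfl | rfl
  · exact ⟨_, _, key (C.B 1) (C.B 0) rfl⟩
  · exact ⟨_, _, key (C.B 0) (C.B 1) rfl⟩
  · exact ⟨_, _, key (C.B 2) (C.B 2) rfl⟩

theorem pauliWt_pauliAt_add {σ σ' : Sector} {d d' : DataQubit ℓ m} (h : d ≠ d') :
    pauliWt (σ.pauliAt d + σ'.pauliAt d') = 2 := by
  refine Eq.trans ?_ (Finset.card_pair h)
  rw [pauliWt]
  congr 1
  ext v
  by_cases h1 : v = d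
  · subst h1
    cases σ <;> cases σ' <;> simp [Sector.pauliAt, pauliX, pauliZ, h]
  · by_cases h2 : v = d'
    · subst h2
      cases σ <;> cases σ' <;> simp [Sector.pauliAt, pauliX, pauliZ, h1]
    · cases σ <;> cases σ' <;> simp [Sector.pauliAt, pauliX, pauliZ, h1, h2]

/-- The data Pauli of a pair of active blocks of a `B` round. -/
theorem BBCode.exists_data_of_pair (C : BBCode ℓ m) (pre : Bool) {t : ℕ} (ht : t ∈ bRounds)
    {e e' : Block ℓ m} (he : e ∈ C.activeBlocks t) (he' : e' ∈ C.activeBlocks t) (hne : e ≠ e') :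
    ∃ (σ σ' : Sector) (d d' : DataQubit ℓ m), d ≠ d' ∧ d.1 = σ.reg ∧ d'.1 = σ'.reg ∧
      IsRelevant σ e ∧ IsRelevant σ' e' ∧
      (e.1 = Sum.inr d ∨ e.2 = Sum.inr d) ∧ (e'.1 = Sum.inr d' ∨ e'.2 = Sum.inr d') ∧
      C.propagate pre t (pairPauli s(e, e')) = σ.pauliAt d + σ'.pauliAt d' := by
  obtain ⟨b, b', hb⟩ := C.exists_of_mem_activeBlocks ht
  rw [C.propagate_pairPauli, dataPart_pairPauli]
  obtain ⟨i, rfl | rfl⟩ := hb e he <;> obtain ⟨j, rfl | rfl⟩ := hb e' he'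
  -- Within one type the data qubit determines the block, since translation is injective; across
  -- types the data registers differ.
  · refine ⟨.X, .X, (.L, i - b'), (.L, j - b'), fun h => hne ?_, rfl, rfl, trivial, trivial,
      Or.inl rfl, Or.inl rfl, by rw [dataPart_blockPauli_L, dataPart_blockPauli_L]⟩
    rw [sub_left_injective (Prod.ext_iff.1 h).2]
  · exact ⟨.X, .Z, (.L, i - b'), (.R, j + b), fun h => by simp at h, rfl, rfl, trivial, trivial,
      Or.inl rfl, Or.inr rfl, by rw [dataPart_blockPauli_L, dataPart_blockPauli_R]⟩
  · exact ⟨.Z, .X, (.R, i + b), (.L, j - b'), fun h => by simp at h, rfl, rfl, trivial, trivial,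
      Or.inr rfl, Or.inl rfl, by rw [dataPart_blockPauli_R, dataPart_blockPauli_L]⟩
  · refine ⟨.Z, .Z, (.R, i + b), (.R, j + b), fun h => hne ?_, rfl, rfl, trivial, trivial,
      Or.inr rfl, Or.inr rfl, by rw [dataPart_blockPauli_R, dataPart_blockPauli_R]⟩
    rw [add_left_injective b (Prod.ext_iff.1 h).2]

-- Identifies the sectors produced by `BBCode.exists_data_of_pair` with the sector prescribed in the
-- main theorem.
omit [NeZero ℓ] [NeZero m] in
theorem IsRelevant.unique {σ σ' : Sector} {e : Block ℓ m} (h : IsRelevant σ e)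
    (h' : IsRelevant σ' e) : σ = σ' := by
  obtain ⟨(⟨_ | _, i⟩ | ⟨_ | _, i⟩), (⟨_ | _, j⟩ | ⟨_ | _, j⟩)⟩ := e <;>
    cases σ <;> cases σ' <;> first | rfl | exact h.elim | exact h'.elim

theorem BBCode.pauliWt_propagate_pair (C : BBCode ℓ m) (pre : Bool) {t : ℕ} (ht : t ∈ bRounds)
    {e e' : Block ℓ m} (he : e ∈ C.activeBlocks t) (he' : e' ∈ C.activeBlocks t) (hne : e ≠ e') :
    pauliWt (C.propagate pre t (pairPauli s(e, e'))) = 2 := by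
  obtain ⟨σ, σ', d, d', hd, -, -, -, -, -, -, h⟩ := C.exists_data_of_pair pre ht he he' hne
  rw [h, pauliWt_pauliAt_add hd]

/-! ### The discarded mass -/

theorem pauliWt_restrict_le {V : Type*} [Fintype V] (σ : Sector) (P : Pauli V) :
    pauliWt (σ.restrict P) ≤ pauliWt P := by
  refine Finset.card_le_card fun v hv => ?_
  simp only [Finset.mem_filter, Finset.mem_univ, true_and] at hv ⊢
  cases σ
  · exact Or.inl (hv.resolve_right fun h => h rfl)
  · exact Or.inr (hv.resolve_left fun h => h rfl)

/-- A set of events whose data Pauli has weight at least `3` in a sector has two or more events. -/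
theorem BBCode.two_le_card_of_weight (C : BBCode ℓ m) (pre : Bool) {t : ℕ} (ht : t ∈ bRounds)
    {E : Finset (Block ℓ m)} (hE : E ⊆ C.activeBlocks t) (σ : Sector)
    {B : Finset (Sym2 (Block ℓ m))} (hB : B ⊆ blockPairs E)
    (h : 3 ≤ pauliWt (σ.restrict (C.propagate pre t (∑ a ∈ B, pairPauli a)))) :
    2 ≤ B.card := by
  -- Restriction to a sector cannot raise the weight, so it suffices that no event gives weight 0
  -- and one event gives weight 2.
  replace h := h.trans (pauliWt_restrict_le σ _)
  by_contra hlt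
  obtain hc | hc : B.card = 0 ∨ B.card = 1 := by omega
  · rw [Finset.card_eq_zero.1 hc, Finset.sum_empty, C.propagate_zero] at h
    simp [pauliWt] at h
  · obtain ⟨a, rfl⟩ := Finset.card_eq_one.1 hc
    rw [Finset.sum_singleton] at h
    have ha := hB (Finset.mem_singleton_self a)
    induction a using Sym2.ind with
    | _ e e' =>
      obtain ⟨h1, h2⟩ := Finset.mem_filter.1 ha
      rw [Finset.mk_mem_sym2_iff] at h1
      rw [C.pauliWt_propagate_pair pre ht (hE h1.1) (hE h1.2) (by simpa using h2)] at h
      omega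

/-- Mass of a pushforward on a set is mass on its preimage. Two uses unwind the definition of the
discarded mass, first through sector restriction and then through propagation. -/
theorem sum_ite_sum_fiber {α β : Type*} [Fintype α] [Fintype β] [DecidableEq β] (f : α → β)
    (F : α → ℝ) (c : β → Prop) [DecidablePred c] :
    (∑ b, if c b then ∑ a, (if f a = b then F a else 0) else 0) =
      ∑ a, if c (f a) then F a else 0 := by
  rw [← Finset.sum_filter, Finset.sum_comm]
  refine Finset.sum_congr rfl fun a _ => ?_
  simp

theorem discardedMass_eq (C : BBCode ℓ m) (g : Geometry ℓ m) (pre : Bool) (t : ℕ)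
    (E : Finset (Block ℓ m)) (σ : Sector) :
    discardedMass C g pre t E σ = ∑ Q : Pauli (Qubit ℓ m),
      if 3 ≤ pauliWt (σ.restrict (C.propagate pre t Q)) then twirlProb (g.unitary E) Q else 0 :=
  (sum_ite_sum_fiber σ.restrict (dataProb C g pre t E) fun P => 3 ≤ pauliWt P).trans
    (sum_ite_sum_fiber (C.propagate pre t) (twirlProb (g.unitary E))
      fun D => 3 ≤ pauliWt (σ.restrict D))

theorem Geometry.unitary_eq (g : Geometry ℓ m) (E : Finset (Block ℓ m)) :
    g.unitary E = ∑ Q, pauliAmplitude pairPauli g.theta (blockPairs E) Q • pauliOp Q := by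
  rw [← exp_sum_eq_sum_pauliAmplitude pairPauli pairPauli_mem_splitPaulis]
  unfold Geometry.unitary Geometry.hamiltonian
  congr 1
  rw [smul_smul, Finset.smul_sum]
  refine Finset.sum_congr rfl fun a _ => ?_
  rw [smul_smul]
  congr 1
  simp only [Geometry.theta]
  push_cast; ring

/-- The twirled tick is a mixture of Pauli conjugations; linearity and `BBCode.toData_conj` push
each one to the data, and collecting equal data Paulis gives `dataProb`. -/
theorem toData_pauliTwirl (C : BBCode ℓ m) (g : Geometry ℓ m) (pre : Bool) (t : ℕ)
    (E : Finset (Block ℓ m)) (ρ : Op (Qubit ℓ m)) :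
    C.toData pre t (pauliTwirl (g.chan E) ρ) = ∑ P : Pauli (DataQubit ℓ m),
      (dataProb C g pre t E P : ℂ) • (pauliOp P * C.toData pre t ρ * pauliOp P) := by
  set u := pauliAmplitude pairPauli g.theta (blockPairs E)
  have hU : g.unitary E = ∑ Q, u Q • pauliOp Q := g.unitary_eq E
  have hchan : g.chan E = fun ρ => (∑ R, u R • pauliOp R) * ρ * (∑ R, u R • pauliOp R)ᴴ := by
    funext ρ; rw [← hU]; rfl
  have hlin := C.isLinearMap_toData pre t
  rw [hchan, pauliTwirl_sum]
  change hlin.mk' _ _ = _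
  rw [map_sum]
  simp only [map_smul, IsLinearMap.mk'_apply, C.toData_conj, dataProb, hU, twirlProb_sum]
  push_cast
  simp only [Finset.sum_smul]
  rw [Finset.sum_comm]
  refine Finset.sum_congr rfl fun Q _ => ?_
  simp [apply_ite, ite_smul]

theorem discardedMass_le (C : BBCode ℓ m) (g : Geometry ℓ m) (pre : Bool) {t : ℕ}
    (ht : t ∈ bRounds) {E : Finset (Block ℓ m)} (hE : E ⊆ C.activeBlocks t) (σ : Sector) :
    discardedMass C g pre t E σ ≤ (collisionMult E : ℝ) * probTwoOrMore g E := by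
  rw [discardedMass_eq, g.unitary_eq]
  simp only [twirlProb_sum]
  refine sum_norm_sq_pauliAmplitude_le pairPauli g.theta (blockPairs E)
    (fun Q => 3 ≤ pauliWt (σ.restrict (C.propagate pre t Q))) _
    (fun B hB h => C.two_le_card_of_weight pre ht hE σ hB h) fun Q => ?_
  exact Finset.le_sup (f := fun Q => ((blockPairs E).powerset.filter fun B =>
    ∑ a ∈ B, pairPauli a = Q ∧ 2 ≤ B.card).card) (Finset.mem_univ Q)

theorem probTwoOrMore_le (g : Geometry ℓ m) (E : Finset (Block ℓ m)) :
    probTwoOrMore g E ≤ g.Theta E ^ 4 / 2 := by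
  have h0 : 0 ≤ ∑ a ∈ blockPairs E, g.theta a ^ 2 := Finset.sum_nonneg fun _ _ => sq_nonneg _
  have hT : g.Theta E ^ 4 = (∑ a ∈ blockPairs E, g.theta a ^ 2) ^ 2 := by
    rw [Geometry.Theta, show 4 = 2 * 2 from rfl, pow_mul, Real.sq_sqrt h0]
  rw [hT]
  refine (bernoulliTail_two_le (p := fun a => Real.sin (g.theta a) ^ 2) (fun _ => sq_nonneg _)
    (fun _ => Real.sin_sq_le_one _) (blockPairs E)).trans ?_
  have hle : ∑ a ∈ blockPairs E, Real.sin (g.theta a) ^ 2 ≤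
      ∑ a ∈ blockPairs E, g.theta a ^ 2 := by
    refine Finset.sum_le_sum fun a _ => ?_
    exact sq_le_sq.2 Real.abs_sin_le_abs
  have := Finset.sum_nonneg fun a (_ : a ∈ blockPairs E) => sq_nonneg (Real.sin (g.theta a))
  gcongr

end Rounds

end BBSchedule

theorem mainTheorem8 {ℓ m : ℕ} [NeZero ℓ] [NeZero m] (C : BBSchedule.BBCode ℓ m) :
    -- every single-pair event in a `B` round propagates to a data Pauli of weight 2
    (∀ (pre : Bool), ∀ t ∈ BBSchedule.bRounds,
      ∀ e ∈ C.activeBlocks t, ∀ e' ∈ C.activeBlocks t, e ≠ e' →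
        (∀ ρ : BBSchedule.Op (BBSchedule.Qubit ℓ m),
          C.toData pre t
              (BBSchedule.pauliOp (BBSchedule.pairPauli s(e, e')) * ρ *
                BBSchedule.pauliOp (BBSchedule.pairPauli s(e, e'))) =
            BBSchedule.pauliOp (C.propagate pre t (BBSchedule.pairPauli s(e, e'))) *
              C.toData pre t ρ *
              BBSchedule.pauliOp (C.propagate pre t (BBSchedule.pairPauli s(e, e')))) ∧
        BBSchedule.pauliWt (C.propagate pre t (BBSchedule.pairPauli s(e, e'))) = 2 ∧
        -- for two sector-relevant blocks: the sector Pauli on the data qubits of the two blocks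
        (∀ σ : BBSchedule.Sector, BBSchedule.IsRelevant σ e → BBSchedule.IsRelevant σ e' →
          ∃ d d' : BBSchedule.DataQubit ℓ m, d ≠ d' ∧ d.1 = σ.reg ∧ d'.1 = σ.reg ∧
            (e.1 = Sum.inr d ∨ e.2 = Sum.inr d) ∧ (e'.1 = Sum.inr d' ∨ e'.2 = Sum.inr d') ∧
            C.propagate pre t (BBSchedule.pairPauli s(e, e')) = σ.pauliAt d + σ.pauliAt d')) ∧
    -- the discarded mass is `O(Θ_t⁴)`, with a constant that depends on the code only
    (∃ mstar : ℕ, ∀ t ∈ BBSchedule.bRounds, ∀ E ⊆ C.activeBlocks t,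
      BBSchedule.collisionMult E ≤ mstar ∧
      ∀ g : BBSchedule.Geometry ℓ m,
        BBSchedule.probTwoOrMore g E ≤ g.Theta E ^ 4 / 2 ∧
        ∀ pre : Bool,
          -- `dataProb` gives the Pauli probabilities of the twirled data channel
          (∀ ρ : BBSchedule.Op (BBSchedule.Qubit ℓ m),
            C.toData pre t (BBSchedule.pauliTwirl (g.chan E) ρ) =
              ∑ P : BBSchedule.Pauli (BBSchedule.DataQubit ℓ m),
                (BBSchedule.dataProb C g pre t E P : ℂ) •
                  (BBSchedule.pauliOp P * C.toData pre t ρ * BBSchedule.pauliOp P)) ∧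
          ∀ σ : BBSchedule.Sector,
            BBSchedule.discardedMass C g pre t E σ ≤
              (BBSchedule.collisionMult E : ℝ) * BBSchedule.probTwoOrMore g E ∧
            BBSchedule.discardedMass C g pre t E σ ≤ (mstar : ℝ) / 2 * g.Theta E ^ 4) := by

  refine ⟨fun pre t ht e he e' he' hne => ⟨C.toData_conj pre t _,
    C.pauliWt_propagate_pair pre ht he he' hne, fun σ hσ hσ' => ?_⟩,
    -- There are finitely many rounds and finitely many sets of active blocks, so the maximum
    -- multiplicity involves no geometry.
    BBSchedule.bRounds.sup fun t => (C.activeBlocks t).powerset.sup BBSchedule.collisionMult,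
    fun t ht E hE => ?_⟩
  · obtain ⟨τ, τ', d, d', hd, h1, h2, h3, h4, h5, h6, h7⟩ :=
      C.exists_data_of_pair pre ht he he' hne
    obtain rfl := hσ.unique h3
    obtain rfl := hσ'.unique h4
    exact ⟨d, d', hd, h1, h2, h5, h6, h7⟩
  · have hm : BBSchedule.collisionMult E ≤ BBSchedule.bRounds.sup fun t =>
        (C.activeBlocks t).powerset.sup BBSchedule.collisionMult :=
      (Finset.le_sup (f := BBSchedule.collisionMult) (Finset.mem_powerset.2 hE)).trans
        (Finset.le_sup (f := fun t => (C.activeBlocks t).powerset.sup BBSchedule.collisionMult) ht)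
    refine ⟨hm, fun g => ⟨BBSchedule.probTwoOrMore_le g E, fun pre =>
      ⟨BBSchedule.toData_pauliTwirl C g pre t E, fun σ =>
        ⟨BBSchedule.discardedMass_le C g pre ht hE σ, ?_⟩⟩⟩⟩
    refine (BBSchedule.discardedMass_le C g pre ht hE σ).trans ?_
    rw [div_mul_eq_mul_div, mul_div_assoc]
    exact mul_le_mul (Nat.cast_le.2 hm) (BBSchedule.probTwoOrMore_le g E)
      (BBSchedule.bernoulliTail_nonneg (fun _ => sq_nonneg _) (fun _ => Real.sin_sq_le_one _) 2 _)
      (Nat.cast_nonneg _)
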